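/- Let $d\in\mathbb N$, $\beta>0$, and let $\mu$ be a $\beta$-semi-log-convex probability measure on $\mathbb R^d$, i.e. $\mu$ has a positive Lebesgue density $\rho$ with $-\nabla^2\log\rho\preceq\beta\,\mathrm{Id}_d$, in the sense that $x\mapsto\log\rho(x)+\frac{\beta}{2}\|x\|^2$ is convex on $\mathbb R^d$. Let $\gamma_d$ be the standard Gaussian measure on $\mathbb R^d$, $f=\frac{d\mu}{d\gamma_d}$, and, for $t>0$, $$Q_tf(x)=\int_{\mathbb R^d}f\big(e^{-t}x+\sqrt{1-e^{-2t}}\,y\big)\,d\gamma_d(y),\qquad V_t=-\nabla\log Q_tf .$$ Then, for every $x\in\mathbb R^d$, there is a unique curve $t\mapsto S_t(x)$ on $[0,\infty)$ with $S_0(x)=x$ that is continuous at $t=0$ and satisfies $\frac{d}{dt}S_t(x)=V_t(S_t(x))$ for all $t>0$, and the limit $S(x)=\lim_{t\to\infty}S_t(x)$ exists. The map $(\Phi)^{-1}:=S:\mathbb R^d\to\mathbb R^d$ so defined, called the inverse Kim–Milman map of $\mu$, satisfies $(\Phi)^{-1}_*\mu=\gamma_d$, is differentiable at almost every $x\in\mathbb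 R^d$, and $$\|D(\Phi)^{-1}(x)\|_{\mathrm{op}}\le\sqrt{\beta}\qquad\text{for almost every }x\in\mathbb R^d .$$ -/

import Mathlib

open MeasureTheory ProbabilityTheory Filter Topology

noncomputable section

namespace KimMilman

/-- `ℝ^d` with its Euclidean norm. -/
abbrev E (d : ℕ) : Type := EuclideanSpace ℝ (Fin d)

/-- The standard Gaussian measure `γ_d` on `ℝ^d`. -/
abbrev gaussian (d : ℕ) : Measure (E d) := stdGaussian (E d)

/-- `μ` is `β`-semi-log-convex, i.e. `-∇² log (dμ/dx) ⪯ β Id`: it has a positive Lebesgue density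
`ρ` for which `log ρ + (β / 2) ‖x‖²` is convex on `ℝ^d`. For `ρ` of class `C²` the convexity says
exactly that the Hessian of `log ρ` plus `β Id` is positive semidefinite at every point;
no smoothness of `ρ` is required. -/
def IsSemiLogConvex {d : ℕ} (β : ℝ) (μ : Measure (E d)) : Prop :=
  ∃ ρ : E d → ℝ, (∀ x, 0 < ρ x) ∧
    μ = (volume : Measure (E d)).withDensity (fun x => ENNReal.ofReal (ρ x)) ∧
    ConvexOn ℝ Set.univ (fun x => Real.log (ρ x) + β / 2 * ‖x‖ ^ 2)

/-- The Ornstein–Uhlenbeck semigroup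
`Q_t g (x) = ∫ g (e^{-t} x + √(1 - e^{-2t}) y) dγ_d(y)`. -/
def ornsteinUhlenbeck {d : ℕ} (t : ℝ) (g : E d → ℝ) (x : E d) : ℝ :=
  ∫ y, g (Real.exp (-t) • x + Real.sqrt (1 - Real.exp (-2 * t)) • y) ∂(gaussian d)

/-- The density `f = dμ/dγ_d`. -/
def gaussianDensity {d : ℕ} (μ : Measure (E d)) (x : E d) : ℝ :=
  (μ.rnDeriv (gaussian d) x).toReal

/-- The vector field `V_t = -∇ log Q_t f`, where `f = dμ/dγ_d`. It is used for `t > 0` only, where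
`Q_t f` does not depend on the version of the density `f`. -/
def velocity {d : ℕ} (μ : Measure (E d)) (t : ℝ) (x : E d) : E d :=
  -gradient (fun z => Real.log (ornsteinUhlenbeck t (gaussianDensity μ) z)) x

/-- `S` is the flow of `V_t` started from the identity:
`S_0(x) = x` and `d/dt S_t(x) = V_t(S_t(x))`. As the density of `μ` need not be differentiable, the
equation is imposed for `t > 0`, together with continuity of `t ↦ S_t(x)` at `t = 0`.
The values `S t` for `t < 0` are irrelevant. -/
structure IsHeatFlow {d : ℕ} (μ : Measure (E d)) (S : ℝ → E d → E d) : Prop where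
  initial : ∀ x, S 0 x = x
  continuous_zero : ∀ x, ContinuousWithinAt (fun t => S t x) (Set.Ici 0) 0
  ode : ∀ x, ∀ t, 0 < t → HasDerivAt (fun s => S s x) (velocity μ t (S t x)) t

/-- `Ψ` is the inverse Kim–Milman map `(Φ)⁻¹ := S = lim_{t → ∞} S_t` of `μ`: the flow `S_t` exists,
is unique for `t ≥ 0`, and converges pointwise to `Ψ`. -/
structure IsInverseKimMilmanMap {d : ℕ} (μ : Measure (E d)) (Ψ : E d → E d) : Prop where
  exists_flow : ∃ S, IsHeatFlow μ S
  unique_flow : ∀ S S', IsHeatFlow μ S → IsHeatFlow μ S' → ∀ t, 0 ≤ t → S t = S' t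
  tendsto : ∀ S, IsHeatFlow μ S → ∀ x, Tendsto (fun t => S t x) atTop (𝓝 (Ψ x))

end KimMilman

end

/-! Write `μ` as `exp (φ - β ‖x‖² / 2) dx` with `φ` convex. By Mehler's formula `Q_t f` is, up to an
explicit Gaussian factor, the mass of the exponential tilt of `μ` with linear parameter `ouB t • x`
and quadratic parameter `ouC t`. For `t > 0` the quadratic damping makes this mass smooth without
any moment of `μ`, and the velocity is the explicit `C¹` field `flowField`
(`velocity_eq_flowField`).

Completing the square turns the tilted mass into a quadratic exponential times a Gaussian
convolution of `exp φ`, and the logarithm of such a convolution is convex (`convexOn_log_heatConv`).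
Hence `(β / ouK β t - 1) • x - V_t x` is the gradient of a convex function, that is, `V_t` is
one-sided Lipschitz with constant `β / k - 1`, where `k = ouK β t` (`inner_flowField_sub_le`). Since
`k' = 2 (β - k)`, this constant is `k' / (2 k)`, so `‖X_t - Y_t‖² / k` decreases along two
trajectories. As `k = 1` at time `0` and `k → β` at infinity, the limit map is `√β`-Lipschitz.
Rademacher's theorem gives the rest of the derivative bound.

The one-sided bound also drives existence and uniqueness. Near `t = 0`, convexity bounds `V_t x` at
each fixed `x` (`exists_bound_flowField_zero`), so solutions started from `x` at times `a → 0` form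
a Cauchy family. Near infinity, `V_t` is bounded on bounded sets by an integrable rate with an
arctangent primitive (`exists_bound_flowField_atTop`), so trajectories converge.

For the transport, Liouville's formula and the continuity equation along trajectories show that the
flow between positive times carries one Ornstein–Uhlenbeck law to the other (`map_flow_ouLaw`). The
contraction lets the initial time tend to `0`, and the final time then tends to infinity, where
these laws converge to `γ_d`. -/

noncomputable section

namespace KimMilman

set_option linter.unusedSectionVars false

open Set Metric
open scoped NNReal RealInnerProductSpace ENNReal

/-! ### Radial cutoff. -/

section Cutoff

variable {V : Type*} [SeminormedAddCommGroup V]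

/-- The piecewise linear cutoff equal to `1` on the ball of radius `R` and to `0` outside the ball
of radius `2 R`. -/
def radialCutoff (R : ℝ) (x : V) : ℝ := max 0 (min 1 (2 - ‖x‖ / R))

lemma radialCutoff_nonneg (R : ℝ) (x : V) : 0 ≤ radialCutoff R x := le_max_left _ _

lemma radialCutoff_le_one (R : ℝ) (x : V) : radialCutoff R x ≤ 1 :=
  max_le zero_le_one (min_le_left _ _)

lemma radialCutoff_eq_one {R : ℝ} (hR : 0 < R) {x : V} (hx : ‖x‖ ≤ R) : radialCutoff R x = 1 := by
  have : ‖x‖ / R ≤ 1 := (div_le_one hR).2 hx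
  rw [radialCutoff, min_eq_left (by linarith), max_eq_right zero_le_one]

lemma radialCutoff_eq_zero {R : ℝ} (hR : 0 < R) {x : V} (hx : 2 * R ≤ ‖x‖) :
    radialCutoff R x = 0 := by
  have : 2 ≤ ‖x‖ / R := (le_div_iff₀ hR).2 hx
  exact max_eq_left ((min_le_right _ _).trans (by linarith))

lemma abs_radialCutoff_sub_le {R : ℝ} (hR : 0 < R) (x y : V) :
    |radialCutoff R x - radialCutoff R y| ≤ R⁻¹ * ‖x - y‖ := by
  refine (abs_max_sub_max_le_max _ _ _ _).trans (max_le (by simp; positivity) ?_)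
  refine (abs_min_sub_min_le_max _ _ _ _).trans (max_le (by simp; positivity) ?_)
  have h : (2 - ‖x‖ / R) - (2 - ‖y‖ / R) = -(R⁻¹ * (‖x‖ - ‖y‖)) := by
    field_simp; ring
  rw [h, abs_neg, abs_mul, abs_of_pos (inv_pos.2 hR)]
  gcongr
  exact abs_norm_sub_norm_le x y

end Cutoff

/-! ### Global existence for locally Lipschitz fields with one-sided growth. -/

section ODE

variable {V : Type*} [NormedAddCommGroup V] [InnerProductSpace ℝ V]

lemma isIntegralCurveOn_hasDerivWithinAt_Ici {γ : ℝ → V} {v : ℝ → V → V} {a b t : ℝ}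
    (h : IsIntegralCurveOn γ v (Icc a b)) (ht : t ∈ Ico a b) :
    HasDerivWithinAt γ (v t (γ t)) (Ici t) t :=
  (h t ⟨ht.1, ht.2.le⟩).mono_of_mem_nhdsWithin
    (mem_of_superset (Icc_mem_nhdsGE ht.2) (Icc_subset_Icc_left ht.1))

lemma isIntegralCurveOn_hasDerivWithinAt_Iic {γ : ℝ → V} {v : ℝ → V → V} {a b t : ℝ}
    (h : IsIntegralCurveOn γ v (Icc a b)) (ht : t ∈ Ioc a b) :
    HasDerivWithinAt γ (v t (γ t)) (Iic t) t :=
  (h t ⟨ht.1.le, ht.2⟩).mono_of_mem_nhdsWithin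
    (mem_of_superset (Icc_mem_nhdsLE ht.1) (Icc_subset_Icc_right ht.2))

/-- A priori bound for integral curves of a vector field with at most linear outward growth. -/
lemma one_add_norm_sq_le_of_growth {v : ℝ → V → V} {γ : ℝ → V} {a b C : ℝ}
    (hC : ∀ t ∈ Icc a b, ∀ x, ⟪v t x, x⟫ ≤ C * (1 + ‖x‖ ^ 2))
    (hγ : IsIntegralCurveOn γ v (Icc a b)) {t : ℝ} (ht : t ∈ Icc a b) :
    1 + ‖γ t‖ ^ 2 ≤ Real.exp (2 * C * (t - a)) * (1 + ‖γ a‖ ^ 2) := by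
  have hanti : AntitoneOn (fun t => Real.exp (-(2 * C * (t - a))) * (1 + ‖γ t‖ ^ 2)) (Icc a b) := by
    have hder : ∀ t ∈ Icc a b, HasDerivWithinAt
        (fun t => Real.exp (-(2 * C * (t - a))) * (1 + ‖γ t‖ ^ 2))
        (Real.exp (-(2 * C * (t - a))) * (-(2 * C)) * (1 + ‖γ t‖ ^ 2) +
          Real.exp (-(2 * C * (t - a))) * (2 * ⟪γ t, v t (γ t)⟫)) (Icc a b) t := by
      intro t ht
      have h1 : HasDerivAt (fun t => -(2 * C * (t - a))) (-(2 * C)) t := by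
        simpa using (((hasDerivAt_id t).sub_const a).const_mul (2 * C)).fun_neg
      exact h1.exp.hasDerivWithinAt.mul ((hγ t ht).norm_sq.const_add 1)
    refine antitoneOn_of_hasDerivWithinAt_nonpos (convex_Icc a b)
      (fun t ht => (hder t ht).continuousWithinAt)
      (fun t ht => (hder t (interior_subset ht)).mono interior_subset) (fun t ht => ?_)
    have := hC t (interior_subset ht) (γ t)
    rw [real_inner_comm] at this
    have he := Real.exp_pos (-(2 * C * (t - a)))
    nlinarith
  have h := hanti (left_mem_Icc.2 (ht.1.trans ht.2)) ht ht.1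
  simp only [sub_self, mul_zero, neg_zero, Real.exp_zero, one_mul] at h
  rw [Real.exp_neg, inv_mul_le_iff₀ (Real.exp_pos _)] at h
  exact h

/-- Existence on a whole compact interval for locally Lipschitz vector fields with at most linear
outward growth. -/
theorem exists_isIntegralCurveOn_of_growth [CompleteSpace V] {v : ℝ → V → V} {a b C : ℝ}
    (hab : a ≤ b) (hC0 : 0 ≤ C)
    (hC : ∀ t ∈ Icc a b, ∀ x, ⟪v t x, x⟫ ≤ C * (1 + ‖x‖ ^ 2))
    (hlip : ∀ R : ℝ, ∃ K : ℝ≥0, ∀ t ∈ Icc a b, LipschitzOnWith K (v t) (closedBall 0 R))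
    (hcont : ∀ x, ContinuousOn (fun t => v t x) (Icc a b)) (x : V) :
    ∃ γ : ℝ → V, γ a = x ∧ IsIntegralCurveOn γ v (Icc a b) := by
  -- `R` is the a priori bound of `one_add_norm_sq_le_of_growth`, so a trajectory from `x` never
  -- sees where the cutoff differs from `1`.
  obtain ⟨R, hR, hRx⟩ : ∃ R : ℝ, 0 < R ∧
      Real.exp (2 * C * (b - a)) * (1 + ‖x‖ ^ 2) ≤ R ^ 2 := by
    refine ⟨Real.sqrt (Real.exp (2 * C * (b - a)) * (1 + ‖x‖ ^ 2)), by positivity, ?_⟩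
    rw [Real.sq_sqrt (by positivity)]
  obtain ⟨K, hK⟩ := hlip (2 * R)
  obtain ⟨M₀, hM₀⟩ := isCompact_Icc.exists_bound_of_continuousOn (hcont 0)
  set M : ℝ := M₀ + K * (2 * R) with hM
  have hbound : ∀ t ∈ Icc a b, ∀ y : V, ‖y‖ ≤ 2 * R → ‖v t y‖ ≤ M := by
    intro t ht y hy
    have h1 := (hK t ht).dist_le_mul y (by simpa using hy) 0 (by simp; positivity)
    rw [dist_eq_norm, dist_zero_right] at h1
    calc ‖v t y‖ = ‖v t 0 + (v t y - v t 0)‖ := by congr 1; abel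
      _ ≤ ‖v t 0‖ + ‖v t y - v t 0‖ := norm_add_le _ _
      _ ≤ M₀ + K * (2 * R) := add_le_add (hM₀ t ht) (h1.trans (by gcongr))
  have hM0 : 0 ≤ M := (norm_nonneg _).trans (hbound a ⟨le_rfl, hab⟩ 0 (by simp; positivity))
  -- The truncated field is bounded and globally Lipschitz, so Picard–Lindelöf covers the whole
  -- interval at once, in a ball of radius `M * (b - a)`.
  set w : ℝ → V → V := fun t y => radialCutoff R y • v t y with hw
  have hwbound : ∀ t ∈ Icc a b, ∀ y : V, ‖w t y‖ ≤ M := by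
    intro t ht y
    rcases le_total ‖y‖ (2 * R) with hy | hy
    · rw [hw, norm_smul, Real.norm_of_nonneg (radialCutoff_nonneg R y)]
      calc _ ≤ 1 * M := mul_le_mul (radialCutoff_le_one R y) (hbound t ht y hy)
            (norm_nonneg _) zero_le_one
        _ = M := one_mul M
    · simp [hw, radialCutoff_eq_zero hR hy, hM0]
  have hwlip : ∀ t ∈ Icc a b, LipschitzWith (K + Real.toNNReal (R⁻¹ * M)) (w t) := by
    intro t ht
    have key : ∀ y z : V, ‖y‖ ≤ 2 * R →
        ‖w t y - w t z‖ ≤ (K + R⁻¹ * M) * ‖y - z‖ := by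
      intro y z hy
      rcases le_total ‖z‖ (2 * R) with hz | hz
      · have h1 : w t y - w t z = radialCutoff R z • (v t y - v t z) +
            (radialCutoff R y - radialCutoff R z) • v t y := by
          simp only [hw, smul_sub, sub_smul]; abel
        have h2 := (hK t ht).dist_le_mul y (by simpa using hy) z (by simpa using hz)
        rw [dist_eq_norm, dist_eq_norm] at h2
        rw [h1, add_mul]
        refine (norm_add_le _ _).trans (add_le_add ?_ ?_)
        · rw [norm_smul, Real.norm_of_nonneg (radialCutoff_nonneg R z)]
          calc _ ≤ 1 * (K * ‖y - z‖) := mul_le_mul (radialCutoff_le_one R z) h2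
                (norm_nonneg _) zero_le_one
            _ = _ := one_mul _
        · rw [norm_smul, Real.norm_eq_abs]
          calc _ ≤ R⁻¹ * ‖y - z‖ * M := mul_le_mul (abs_radialCutoff_sub_le hR y z)
                (hbound t ht y hy) (norm_nonneg _) (by positivity)
            _ = _ := by ring
      · have h0 := radialCutoff_eq_zero hR hz
        have h1 : w t y - w t z = (radialCutoff R y - radialCutoff R z) • v t y := by
          simp [hw, h0]
        rw [h1, add_mul, norm_smul, Real.norm_eq_abs]
        calc _ ≤ R⁻¹ * ‖y - z‖ * M := mul_le_mul (abs_radialCutoff_sub_le hR y z)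
                (hbound t ht y hy) (norm_nonneg _) (by positivity)
          _ = R⁻¹ * M * ‖y - z‖ := by ring
          _ ≤ _ := le_add_of_nonneg_left (by positivity)
    refine LipschitzWith.of_dist_le_mul fun y z => ?_
    rw [dist_eq_norm, dist_eq_norm, NNReal.coe_add, Real.coe_toNNReal _ (by positivity)]
    rcases le_total ‖y‖ (2 * R) with hy | hy
    · exact key y z hy
    rcases le_total ‖z‖ (2 * R) with hz | hz
    · rw [norm_sub_rev (w t y), norm_sub_rev y]; exact key z y hz
    · simp only [hw, radialCutoff_eq_zero hR hy, radialCutoff_eq_zero hR hz, zero_smul, sub_zero,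
        norm_zero]
      positivity
  have hPL : IsPicardLindelof w (⟨a, left_mem_Icc.2 hab⟩ : Icc a b) x
      (Real.toNNReal (M * (b - a))) 0 (Real.toNNReal M) (K + Real.toNNReal (R⁻¹ * M)) := by
    refine ⟨fun t ht => (hwlip t ht).lipschitzOnWith, fun y _ => (hcont y).const_smul _,
      fun t ht y _ => ?_, ?_⟩
    · rw [Real.coe_toNNReal _ hM0]; exact hwbound t ht y
    · rw [Real.coe_toNNReal _ hM0, Real.coe_toNNReal _ (mul_nonneg hM0 (sub_nonneg.2 hab))]
      simp [sub_nonneg.2 hab]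
  obtain ⟨γ, hγa, hγ⟩ := hPL.exists_eq_forall_mem_Icc_hasDerivWithinAt₀
  refine ⟨γ, hγa, fun t ht => ?_⟩
  -- A factor in `[0, 1]` preserves the growth bound because its right side is nonnegative; the a
  -- priori bound therefore holds for the truncated trajectory too.
  have hgw : ∀ t ∈ Icc a b, ∀ y, ⟪w t y, y⟫ ≤ C * (1 + ‖y‖ ^ 2) := by
    intro t ht y
    rw [hw, real_inner_smul_left]
    have h0 := radialCutoff_nonneg R y
    have h1 := radialCutoff_le_one R y
    have h2 := hC t ht y
    have h3 : 0 ≤ C * (1 + ‖y‖ ^ 2) := by positivity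
    nlinarith
  have hb := one_add_norm_sq_le_of_growth hgw hγ ht
  have hle : ‖γ t‖ ≤ R := by
    refine le_of_sq_le_sq ?_ hR.le
    have : Real.exp (2 * C * (t - a)) ≤ Real.exp (2 * C * (b - a)) := by
      gcongr; exact ht.2
    simp only at hγa
    rw [hγa] at hb
    nlinarith [sq_nonneg ‖x‖]
  have := hγ t ht
  simpa [hw, radialCutoff_eq_one hR hle] using this

end ODE

/-! ### Linearised flow and Liouville's formula. -/

section Liouville

variable {V : Type*} [NormedAddCommGroup V] [InnerProductSpace ℝ V]

/-- The Leibniz rule gives a sum of determinants with one row replaced. Row `j` of `A * M` is a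
combination of the rows of `M`, and only the multiple `A j j` of row `j` itself survives. -/
lemma hasDerivWithinAt_matrix_det {n : Type*} [Fintype n] [DecidableEq n] {M : ℝ → Matrix n n ℝ}
    {A : Matrix n n ℝ} {s : Set ℝ} {t : ℝ}
    (hM : ∀ i j, HasDerivWithinAt (fun τ => M τ i j) ((A * M t) i j) s t) :
    HasDerivWithinAt (fun τ => (M τ).det) (A.trace * (M t).det) s t := by
  have hdet : ∀ N : Matrix n n ℝ,
      N.det = ∑ σ : Equiv.Perm n, ((Equiv.Perm.sign σ : ℤ) : ℝ) * ∏ i, N i (σ i) := fun N => by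
    rw [← Matrix.det_transpose, Matrix.det_apply']; rfl
  have h1 : HasDerivWithinAt (fun τ => (M τ).det)
      (∑ σ : Equiv.Perm n, ((Equiv.Perm.sign σ : ℤ) : ℝ) *
        ∑ j, (∏ i ∈ Finset.univ.erase j, M t i (σ i)) • (A * M t) j (σ j)) s t := by
    simp only [hdet]
    refine HasDerivWithinAt.fun_sum fun σ _ => HasDerivWithinAt.const_mul _ ?_
    exact HasDerivWithinAt.fun_finsetProd fun i _ => hM i (σ i)
  convert h1 using 1
  have h2 : ∀ j, A j j * (M t).det = ((M t).updateRow j ((A * M t) j)).det := fun j => by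
    rw [← smul_eq_mul, ← Matrix.det_updateRow_sum]
    congr 2
    ext l; simp [Matrix.mul_apply]
  rw [Matrix.trace, Finset.sum_mul]
  simp only [Matrix.diag_apply, h2, Finset.mul_sum]
  rw [Finset.sum_comm]
  refine Finset.sum_congr rfl fun j _ => ?_
  rw [hdet]
  refine Finset.sum_congr rfl fun σ _ => ?_
  rw [← Finset.prod_erase_mul _ _ (Finset.mem_univ j), Matrix.updateRow_self, smul_eq_mul]
  congr 2
  exact Finset.prod_congr rfl fun i hi => by rw [Matrix.updateRow_ne (Finset.ne_of_mem_erase hi)]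

/-- Liouville's formula for the determinant of the solution of `J' = A J`, in an orthonormal
basis. -/
lemma hasDerivWithinAt_det {ι : Type*} [Fintype ι] (e : OrthonormalBasis ι ℝ V)
    {J : ℝ → V →L[ℝ] V} {A : V →L[ℝ] V} {s : Set ℝ} {t : ℝ}
    (hJ : ∀ w, HasDerivWithinAt (fun τ => J τ w) (A (J t w)) s t) :
    HasDerivWithinAt (fun τ => (J τ).det) ((∑ i, ⟪e i, A (e i)⟫) * (J t).det) s t := by
  classical
  have hdet : ∀ B : V →L[ℝ] V,
      B.det = (LinearMap.toMatrix e.toBasis e.toBasis (B : V →ₗ[ℝ] V)).det := fun B => by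
    rw [LinearMap.det_toMatrix]
  have hent : ∀ (B : V →L[ℝ] V) i j,
      LinearMap.toMatrix e.toBasis e.toBasis (B : V →ₗ[ℝ] V) i j = ⟪e i, B (e j)⟫ := by
    intro B i j
    simp [LinearMap.toMatrix_apply, e.repr_apply_apply]
  have := hasDerivWithinAt_matrix_det
    (M := fun τ => LinearMap.toMatrix e.toBasis e.toBasis (J τ : V →ₗ[ℝ] V))
    (A := LinearMap.toMatrix e.toBasis e.toBasis (A : V →ₗ[ℝ] V)) (s := s) (t := t) ?_
  · simpa only [← hdet, Matrix.trace, Matrix.diag_apply, hent] using this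
  · intro i j
    have h1 : (LinearMap.toMatrix e.toBasis e.toBasis (A : V →ₗ[ℝ] V) *
        LinearMap.toMatrix e.toBasis e.toBasis (J t : V →ₗ[ℝ] V)) i j = ⟪e i, A (J t (e j))⟫ := by
      rw [← LinearMap.toMatrix_comp]
      exact hent (A ∘L J t) i j
    simp only [h1, hent]
    exact (hasDerivWithinAt_const t s (e i)).inner ℝ (hJ (e j)) |>.congr_deriv (by simp)

/-- Existence of the fundamental solution of a linear ODE. -/
lemma exists_fundamental_solution [FiniteDimensional ℝ V] {A : ℝ → V →L[ℝ] V} {a b : ℝ}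
    (hab : a ≤ b) (hA : ContinuousOn A (Icc a b)) :
    ∃ J : ℝ → V →L[ℝ] V, J a = ContinuousLinearMap.id ℝ V ∧
      ∀ t ∈ Icc a b, ∀ w, HasDerivWithinAt (fun τ => J τ w) (A t (J t w)) (Icc a b) t := by
  obtain ⟨C, hC⟩ := isCompact_Icc.exists_bound_of_continuousOn hA
  have hC0 : 0 ≤ C := (norm_nonneg _).trans (hC a ⟨le_rfl, hab⟩)
  have := fun w : V => exists_isIntegralCurveOn_of_growth (v := fun t x => A t x) hab hC0
    (fun t ht x => by
      have h1 := real_inner_le_norm (A t x) x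
      have h2 := (A t).le_of_opNorm_le (hC t ht) x
      nlinarith [norm_nonneg x])
    (fun R => ⟨Real.toNNReal C, fun t ht => by
      refine ((A t).lipschitz.weaken ?_).lipschitzOnWith
      rw [← NNReal.coe_le_coe, Real.coe_toNNReal _ hC0]; exact hC t ht⟩)
    (fun x => hA.clm_apply continuousOn_const) w
  choose γ hγ0 hγ using this
  let e := stdOrthonormalBasis ℝ V
  refine ⟨fun t => ∑ i, (innerSL ℝ (e i)).smulRight (γ (e i) t), ?_, fun t ht w => ?_⟩
  · ext w
    simp only [_root_.sum_apply, ContinuousLinearMap.smulRight_apply,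
      innerSL_apply_apply, hγ0, ContinuousLinearMap.id_apply]
    exact e.sum_repr' w
  · simp only [_root_.sum_apply, ContinuousLinearMap.smulRight_apply,
      innerSL_apply_apply, map_sum, map_smul]
    exact HasDerivWithinAt.fun_sum fun i _ => (hγ (e i) t ht).const_smul _

/-- Differentiability of a Lipschitz flow with respect to the initial condition. -/
theorem hasFDerivAt_flow {v : ℝ → V → V} {v' : ℝ → V → V →L[ℝ] V} {X : V → ℝ → V}
    {J : ℝ → V →L[ℝ] V} {a b : ℝ} {K : ℝ} (hab : a ≤ b) (hK0 : 0 ≤ K)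
    (hv : ∀ t ∈ Icc a b, ∀ y, HasFDerivAt (v t) (v' t y) y)
    (hv' : ContinuousOn (Function.uncurry v') (Icc a b ×ˢ univ))
    (hX0 : ∀ y, X y a = y) (hX : ∀ y, IsIntegralCurveOn (X y) v (Icc a b))
    (hK : ∀ y z, ∀ t ∈ Icc a b, ‖X y t - X z t‖ ≤ K * ‖y - z‖) (x : V)
    (hJ0 : J a = ContinuousLinearMap.id ℝ V)
    (hJ : ∀ t ∈ Icc a b, ∀ w, HasDerivWithinAt (fun τ => J τ w) (v' t (X x t) (J t w))
      (Icc a b) t) :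
    HasFDerivAt (fun y => X y b) (J b) x := by
  have hXc : ContinuousOn (X x) (Icc a b) := fun t ht => (hX x t ht).continuousWithinAt
  have hAc : ContinuousOn (fun t => v' t (X x t)) (Icc a b) :=
    hv'.comp (continuousOn_id.prodMk hXc) (fun t ht => ⟨ht, mem_univ _⟩)
  obtain ⟨M, hM⟩ := isCompact_Icc.exists_bound_of_continuousOn hAc
  -- Tube lemma: the continuity of `v'` is uniform along the trajectory because the time interval is
  -- compact.
  have hunif : ∀ ε > 0, ∃ δ > 0, ∀ t ∈ Icc a b, ∀ w, ‖w‖ < δ →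
      ‖v' t (X x t + w) - v' t (X x t)‖ ≤ ε := by
    intro ε hε
    have hev : ∀ᶠ w in 𝓝 (0 : V), ∀ t ∈ Icc a b, ‖v' t (X x t + w) - v' t (X x t)‖ < ε := by
      have hg : ContinuousOn (fun p : V × ℝ => ‖v' p.2 (X x p.2 + p.1) - v' p.2 (X x p.2)‖)
          (univ ×ˢ Icc a b) := by
        have h2 : ContinuousOn (fun p : V × ℝ => X x p.2) (univ ×ˢ Icc a b) :=
          hXc.comp continuousOn_snd (fun p hp => hp.2)
        refine ((hv'.comp (continuousOn_snd.prodMk (h2.add continuousOn_fst))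
          (fun p hp => ⟨hp.2, mem_univ _⟩)).sub (hAc.comp continuousOn_snd fun p hp => hp.2)).norm
      refine (isCompact_Icc.eventually_forall_of_forall_eventually
        (P := fun w t => t ∈ Icc a b → ‖v' t (X x t + w) - v' t (X x t)‖ < ε)
        fun t ht => ?_).mono fun w h t ht => h t ht ht
      have h1 := (hg (0, t) ⟨mem_univ _, ht⟩).eventually_lt_const
        (u := ε) (by simpa using hε)
      rw [eventually_nhdsWithin_iff] at h1
      exact h1.mono fun z hz hzt => hz ⟨mem_univ _, hzt⟩
    obtain ⟨δ, hδ, h⟩ := Metric.eventually_nhds_iff.1 hev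
    exact ⟨δ, hδ, fun t ht w hw => (h (by simpa using hw) t ht).le⟩
  -- Enlarging `M` makes the Gronwall constant nonzero, so that `gronwallBound` has its exponential
  -- form, with factor `G`.
  have hMpos : 0 < |M| + 1 := by positivity
  set G : ℝ := (Real.exp ((|M| + 1) * (b - a)) - 1) / (|M| + 1) with hG
  have hG0 : 0 ≤ G := by
    refine div_nonneg (sub_nonneg.2 (Real.one_le_exp ?_)) hMpos.le
    exact mul_nonneg hMpos.le (sub_nonneg.2 hab)
  rw [hasFDerivAt_iff_isLittleO_nhds_zero, Asymptotics.isLittleO_iff]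
  intro c hc
  -- Gronwall will bound the remainder by `ε * K * G * ‖h‖`; this `ε` brings it below `c * ‖h‖`.
  obtain ⟨δ, hδ, hunif⟩ := hunif (c / (K * G + 1)) (by positivity)
  set ε := c / (K * G + 1) with hε
  rw [Metric.eventually_nhds_iff]
  refine ⟨δ / (K + 1), by positivity, fun h hh => ?_⟩
  rw [dist_zero_right, lt_div_iff₀ (by positivity)] at hh
  have hw : ∀ t ∈ Icc a b, ‖X (x + h) t - X x t‖ ≤ K * ‖h‖ := fun t ht => by
    simpa using hK (x + h) x t ht
  have hwδ : ∀ t ∈ Icc a b, ‖X (x + h) t - X x t‖ < δ := fun t ht =>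
    (hw t ht).trans_lt (by nlinarith [norm_nonneg h])
  have hder : ∀ t ∈ Icc a b, HasDerivWithinAt (fun τ => X (x + h) τ - X x τ - J τ h)
      (v t (X (x + h) t) - v t (X x t) - v' t (X x t) (J t h)) (Icc a b) t := fun t ht =>
    ((hX (x + h) t ht).sub (hX x t ht)).sub (hJ t ht h)
  have hgr := norm_le_gronwallBound_of_norm_deriv_right_le (K := |M| + 1) (ε := ε * (K * ‖h‖))
    (δ := 0) (fun t ht => (hder t ht).continuousWithinAt)
    (fun t ht => (hder t ⟨ht.1, ht.2.le⟩).mono_of_mem_nhdsWithin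
      (mem_of_superset (Icc_mem_nhdsGE ht.2) (Icc_subset_Icc_left ht.1)))
    (by simp [hX0, hJ0]) (fun t ht => ?_) b ⟨hab, le_rfl⟩
  · rw [gronwallBound_of_K_ne_0 hMpos.ne'] at hgr
    refine hgr.trans ?_
    calc _ = c * ‖h‖ * (K * G / (K * G + 1)) := by rw [hε, hG]; field_simp; ring
      _ ≤ c * ‖h‖ * 1 := by
        gcongr
        rw [div_le_one (by positivity)]; linarith
      _ = _ := mul_one _
  · replace ht : t ∈ Icc a b := ⟨ht.1, ht.2.le⟩
    have h1 : ‖v t (X (x + h) t) - v t (X x t) - v' t (X x t) (X (x + h) t - X x t)‖ ≤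
        ε * ‖X (x + h) t - X x t‖ := by
      refine (convex_ball (X x t) δ).norm_image_sub_le_of_norm_hasFDerivWithin_le'
        (fun y _ => (hv t ht y).hasFDerivWithinAt) (fun y hy => ?_) (mem_ball_self hδ) ?_
      · simpa using hunif t ht (y - X x t) (by simpa [dist_eq_norm] using hy)
      · simpa [dist_eq_norm] using hwδ t ht
    have h2 : ‖v' t (X x t) (X (x + h) t - X x t - J t h)‖ ≤
        (|M| + 1) * ‖X (x + h) t - X x t - J t h‖ :=
      ContinuousLinearMap.le_of_opNorm_le _ ((hM t ht).trans (by linarith [le_abs_self M])) _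
    have h3 : v t (X (x + h) t) - v t (X x t) - v' t (X x t) (J t h) =
        v' t (X x t) (X (x + h) t - X x t - J t h) +
        (v t (X (x + h) t) - v t (X x t) - v' t (X x t) (X (x + h) t - X x t)) := by
      simp only [map_sub]; abel
    rw [h3]
    refine (norm_add_le _ _).trans (add_le_add h2 (h1.trans ?_))
    gcongr
    exact hw t ht

end Liouville

/-! ### Exponential tilts and their smoothness. -/

section Tilt

/-- The power is at most `n! * exp (1 + u)`; the constant comes from maximising the quadratic `(R +
1) * u - η * u²`. -/
lemma exists_pow_mul_exp_le (n : ℕ) (R : ℝ) {η : ℝ} (hη : 0 < η) :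
    ∃ C : ℝ, 0 ≤ C ∧ ∀ u : ℝ, 0 ≤ u → (1 + u) ^ n * Real.exp (R * u - η * u ^ 2) ≤ C := by
  refine ⟨n.factorial * Real.exp (1 + (R + 1) ^ 2 / (4 * η)), by positivity, fun u hu => ?_⟩
  have h1 := Real.pow_div_factorial_le_exp (1 + u) (by positivity) n
  rw [div_le_iff₀ (by positivity)] at h1
  calc (1 + u) ^ n * Real.exp (R * u - η * u ^ 2)
      ≤ Real.exp (1 + u) * n.factorial * Real.exp (R * u - η * u ^ 2) := by gcongr
    _ = n.factorial * Real.exp ((1 + u) + (R * u - η * u ^ 2)) := by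
      rw [Real.exp_add (1 + u)]; ring
    _ ≤ _ := by
      refine mul_le_mul_of_nonneg_left (Real.exp_le_exp.2 ?_) (by positivity)
      have : (R + 1) ^ 2 / (4 * η) - ((R + 1) * u - η * u ^ 2) =
          (R + 1 - 2 * η * u) ^ 2 / (4 * η) := by field_simp; ring
      have : 0 ≤ (R + 1 - 2 * η * u) ^ 2 / (4 * η) := by positivity
      linarith

section PolyGrowth

variable {V F : Type*} [NormedAddCommGroup V] [NormedAddCommGroup F]

/-- Continuous functions of at most polynomial growth. -/
def PolyGrowth (ψ : V → F) : Prop :=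
  Continuous ψ ∧ ∃ (C : ℝ) (n : ℕ), 0 ≤ C ∧ ∀ z, ‖ψ z‖ ≤ C * (1 + ‖z‖) ^ n

lemma PolyGrowth.const (c : F) : PolyGrowth (fun _ : V => c) :=
  ⟨continuous_const, ‖c‖, 0, norm_nonneg _, by simp⟩

lemma PolyGrowth.id : PolyGrowth (fun z : V => z) :=
  ⟨continuous_id, 1, 1, zero_le_one, fun z => by simp⟩

end PolyGrowth

variable {V : Type*} [NormedAddCommGroup V] [InnerProductSpace ℝ V]
variable {F : Type*} [NormedAddCommGroup F] [NormedSpace ℝ F]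

/-- The exponent of a Gaussian-type exponential tilt, as a linear form in its parameters. -/
def tiltForm (z : V) : V × ℝ →L[ℝ] ℝ :=
  (innerSL ℝ z).comp (ContinuousLinearMap.fst ℝ V ℝ) -
    ‖z‖ ^ 2 • ContinuousLinearMap.snd ℝ V ℝ

@[simp] lemma tiltForm_apply (z : V) (p : V × ℝ) : tiltForm z p = ⟪z, p.1⟫ - ‖z‖ ^ 2 * p.2 := rfl

lemma norm_tiltForm_le (z : V) : ‖tiltForm z‖ ≤ (1 + ‖z‖) ^ 2 := by
  refine ContinuousLinearMap.opNorm_le_bound _ (by positivity) fun p => ?_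
  rw [tiltForm_apply]
  have h1 := norm_inner_le_norm (𝕜 := ℝ) z p.1
  have h2 := norm_fst_le p
  have h3 := norm_snd_le p
  have hz := norm_nonneg z
  calc _ ≤ ‖⟪z, p.1⟫‖ + ‖‖z‖ ^ 2 * p.2‖ := norm_sub_le _ _
    _ ≤ ‖z‖ * ‖p‖ + ‖z‖ ^ 2 * ‖p‖ := by
      refine add_le_add (h1.trans (by gcongr)) ?_
      rw [norm_mul, norm_pow, norm_norm]; gcongr
    _ ≤ _ := by nlinarith [norm_nonneg p, mul_nonneg hz (norm_nonneg p)]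

lemma continuous_tiltForm : Continuous (tiltForm : V → V × ℝ →L[ℝ] ℝ) := by
  unfold tiltForm
  fun_prop

/-- The function `ψ` integrated against the tilted measure
`exp (⟪ξ, z⟫ - η ‖z‖²) μ(dz)`, with `p = (ξ, η)`. -/
def tilt [MeasurableSpace V] (μ : Measure V) (ψ : V → F) (p : V × ℝ) : F :=
  ∫ z, Real.exp (tiltForm z p) • ψ z ∂μ

/-- Differentiating a tilt in its parameters multiplies the integrand by `tiltForm`; closure under
this operation makes the derivative a tilt again. -/
lemma PolyGrowth.smulRight {ψ : V → F} (hψ : PolyGrowth ψ) :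
    PolyGrowth (fun z => (tiltForm z).smulRight (ψ z)) := by
  obtain ⟨hc, C, n, hC, h⟩ := hψ
  refine ⟨((ContinuousLinearMap.smulRightL ℝ (V × ℝ) F).continuous.comp
    continuous_tiltForm).clm_apply hc, C, n + 2, hC, fun z => ?_⟩
  rw [ContinuousLinearMap.norm_smulRight_apply]
  calc _ ≤ (1 + ‖z‖) ^ 2 * (C * (1 + ‖z‖) ^ n) :=
        mul_le_mul (norm_tiltForm_le z) (h z) (norm_nonneg _) (by positivity)
    _ = _ := by ring

/-- On this ball the quadratic parameter stays at least `p.2 / 2`, so the Gaussian factor beats both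
the linear exponential and the polynomial. A constant then dominates, which is integrable for any
finite `μ`. -/
lemma PolyGrowth.exists_bound {ψ : V → F} (hψ : PolyGrowth ψ) {p : V × ℝ} (hp : 0 < p.2) :
    ∃ C : ℝ, ∀ q ∈ ball p (p.2 / 2), ∀ z, ‖Real.exp (tiltForm z q) • ψ z‖ ≤ C := by
  obtain ⟨-, C, n, hC, h⟩ := hψ
  obtain ⟨D, hD, hb⟩ := exists_pow_mul_exp_le n (‖p‖ + p.2 / 2) (half_pos hp)
  refine ⟨C * D, fun q hq z => ?_⟩
  rw [mem_ball, dist_eq_norm] at hq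
  have h1 : ‖q.1‖ ≤ ‖p‖ + p.2 / 2 := by
    have := norm_add_le p (q - p)
    rw [add_sub_cancel] at this
    exact (norm_fst_le q).trans (by linarith)
  have h2 : p.2 / 2 ≤ q.2 := by
    have := (Real.norm_eq_abs _ ▸ norm_snd_le (q - p)).trans hq.le
    rw [Prod.snd_sub, abs_le] at this
    linarith
  have h3 : ⟪z, q.1⟫ ≤ (‖p‖ + p.2 / 2) * ‖z‖ :=
    (real_inner_le_norm z q.1).trans (by rw [mul_comm]; gcongr)
  rw [norm_smul, Real.norm_of_nonneg (Real.exp_pos _).le, tiltForm_apply]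
  calc _ ≤ Real.exp ((‖p‖ + p.2 / 2) * ‖z‖ - p.2 / 2 * ‖z‖ ^ 2) * (C * (1 + ‖z‖) ^ n) := by
        refine mul_le_mul (Real.exp_le_exp.2 (sub_le_sub h3 ?_)) (h z) (norm_nonneg _)
          (Real.exp_pos _).le
        rw [mul_comm]; gcongr
    _ = C * ((1 + ‖z‖) ^ n * Real.exp ((‖p‖ + p.2 / 2) * ‖z‖ - p.2 / 2 * ‖z‖ ^ 2)) := by ring
    _ ≤ C * D := by gcongr; exact hb _ (norm_nonneg _)

variable [MeasurableSpace V] [BorelSpace V] [SecondCountableTopology V]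
  {μ : Measure V} [IsFiniteMeasure μ]

omit [IsFiniteMeasure μ] in
lemma PolyGrowth.aestronglyMeasurable {ψ : V → F} (hψ : PolyGrowth ψ) (p : V × ℝ) :
    AEStronglyMeasurable (fun z => Real.exp (tiltForm z p) • ψ z) μ := by
  have h : Continuous (fun z : V => tiltForm z p) := continuous_tiltForm.clm_apply continuous_const
  exact ((Real.continuous_exp.comp h).smul hψ.1).aestronglyMeasurable

lemma PolyGrowth.integrable {ψ : V → F} (hψ : PolyGrowth ψ) {p : V × ℝ} (hp : 0 < p.2) :
    Integrable (fun z => Real.exp (tiltForm z p) • ψ z) μ := by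
  obtain ⟨C, hC⟩ := hψ.exists_bound hp
  exact Integrable.of_bound (hψ.aestronglyMeasurable p) C
    (Eventually.of_forall fun z => hC p (mem_ball_self (half_pos hp)) z)

lemma hasFDerivAt_tilt {ψ : V → F} (hψ : PolyGrowth ψ) {p : V × ℝ} (hp : 0 < p.2) :
    HasFDerivAt (tilt μ ψ) (tilt μ (fun z => (tiltForm z).smulRight (ψ z)) p) p := by
  obtain ⟨C, hC⟩ := hψ.smulRight.exists_bound hp
  refine hasFDerivAt_integral_of_dominated_of_fderiv_le (bound := fun _ => C)
    (ball_mem_nhds p (half_pos hp)) (Eventually.of_forall fun q => hψ.aestronglyMeasurable q)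
    (hψ.integrable hp) (hψ.smulRight.aestronglyMeasurable p)
    (Eventually.of_forall fun z q hq => hC q hq z) (integrable_const C)
    (Eventually.of_forall fun z q _ => ?_)
  have h1 : HasFDerivAt (fun q => Real.exp (tiltForm z q)) (Real.exp (tiltForm z q) • tiltForm z) q :=
    (tiltForm z).hasFDerivAt.exp
  refine (h1.smul_const (ψ z)).congr_fderiv ?_
  refine ContinuousLinearMap.ext fun w => ?_
  simp [smul_smul]

/-- The derivative is a tilt, hence itself differentiable, hence continuous. -/
lemma contDiffOn_tilt {ψ : V → F} (hψ : PolyGrowth ψ) :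
    ContDiffOn ℝ 1 (tilt μ ψ) {p | 0 < p.2} := by
  have ho : IsOpen {p : V × ℝ | 0 < p.2} := isOpen_lt continuous_const continuous_snd
  rw [show (1 : WithTop ℕ∞) = 0 + 1 from rfl, contDiffOn_succ_iff_fderiv_of_isOpen ho]
  refine ⟨fun p hp => (hasFDerivAt_tilt hψ hp).differentiableAt.differentiableWithinAt, by simp, ?_⟩
  rw [contDiffOn_zero]
  refine ContinuousOn.congr (f := tilt μ (fun z => (tiltForm z).smulRight (ψ z))) (fun p hp => ?_)
    fun p hp => (hasFDerivAt_tilt hψ hp).fderiv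
  exact (hasFDerivAt_tilt hψ.smulRight hp).continuousAt.continuousWithinAt

lemma tilt_one_pos [NeZero μ] {p : V × ℝ} (hp : 0 < p.2) : 0 < tilt μ (fun _ => (1 : ℝ)) p := by
  rw [tilt, integral_pos_iff_support_of_nonneg (fun z => by simp; positivity)
    ((PolyGrowth.const 1).integrable hp)]
  have : Function.support (fun z => Real.exp (tiltForm z p) • (1 : ℝ)) = univ := by
    ext z; simp [(Real.exp_pos _).ne']
  rw [this]
  exact Measure.measure_univ_pos.2 (NeZero.ne μ)

end Tilt

/-! ### Time-dependent coefficients of the Mehler kernel. -/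

section Coefficients

/-- The variance `1 - e^{-2t}` of the Ornstein–Uhlenbeck noise. -/
def ouVar (t : ℝ) : ℝ := 1 - Real.exp (-2 * t)

/-- The coefficient `e^{-2t} / (2 (1 - e^{-2t}))`. -/
def ouC (t : ℝ) : ℝ := Real.exp (-2 * t) / (2 * ouVar t)

/-- The coefficient `e^{-t} / (1 - e^{-2t})`. -/
def ouB (t : ℝ) : ℝ := Real.exp (-t) / ouVar t

lemma exp_neg_two_mul (t : ℝ) : Real.exp (-2 * t) = Real.exp (-t) ^ 2 := by
  rw [← Real.exp_nat_mul]; congr 1; push_cast; ring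

lemma ouVar_pos {t : ℝ} (ht : 0 < t) : 0 < ouVar t := by
  have : Real.exp (-2 * t) < 1 := by rw [Real.exp_lt_one_iff]; linarith
  unfold ouVar; linarith

lemma ouVar_lt_one (t : ℝ) : ouVar t < 1 := by
  have := Real.exp_pos (-2 * t)
  unfold ouVar; linarith

lemma ouC_pos {t : ℝ} (ht : 0 < t) : 0 < ouC t :=
  div_pos (Real.exp_pos _) (mul_pos two_pos (ouVar_pos ht))

lemma ouB_pos {t : ℝ} (ht : 0 < t) : 0 < ouB t := div_pos (Real.exp_pos _) (ouVar_pos ht)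

/-- Here `1 + 2 * ouC t` is `1 / ouVar t`. This identity makes the `‖x‖²` terms cancel in the
continuity equation. -/
lemma ouB_sq {t : ℝ} (ht : 0 < t) : ouB t ^ 2 = 2 * ouC t * (1 + 2 * ouC t) := by
  have h := (ouVar_pos ht).ne'
  have h2 : Real.exp (-t) ^ 2 = 1 - ouVar t := by rw [← exp_neg_two_mul]; unfold ouVar; ring
  unfold ouB ouC
  rw [exp_neg_two_mul, div_pow, h2]
  field_simp
  ring

lemma hasDerivAt_ouVar (t : ℝ) : HasDerivAt ouVar (2 * Real.exp (-2 * t)) t := by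
  have : HasDerivAt (fun t : ℝ => -2 * t) (-2) t := by
    simpa using (hasDerivAt_id t).const_mul (-2)
  exact (this.exp.const_sub 1).congr_deriv (by ring)

lemma hasDerivAt_log_ouVar {t : ℝ} (ht : 0 < t) :
    HasDerivAt (fun t => Real.log (ouVar t)) (4 * ouC t) t := by
  refine ((hasDerivAt_ouVar t).log (ouVar_pos ht).ne').congr_deriv ?_
  unfold ouC
  have := (ouVar_pos ht).ne'
  field_simp; ring

lemma hasDerivAt_ouC {t : ℝ} (ht : 0 < t) : HasDerivAt ouC (-ouB t ^ 2) t := by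
  have h := (ouVar_pos ht).ne'
  have h1 : HasDerivAt (fun t : ℝ => Real.exp (-2 * t)) (Real.exp (-2 * t) * (-2)) t := by
    have : HasDerivAt (fun t : ℝ => -2 * t) (-2) t := by
      simpa using (hasDerivAt_id t).const_mul (-2)
    exact this.exp
  refine (h1.div ((hasDerivAt_ouVar t).const_mul 2) (by simpa using h)).congr_deriv ?_
  unfold ouB
  rw [div_pow, ← exp_neg_two_mul]
  have h2 : Real.exp (-2 * t) = 1 - ouVar t := by unfold ouVar; ring
  rw [h2]
  field_simp
  ring

lemma hasDerivAt_ouB {t : ℝ} (ht : 0 < t) : HasDerivAt ouB (-ouB t * (1 + 4 * ouC t)) t := by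
  have h := (ouVar_pos ht).ne'
  have h1 : HasDerivAt (fun t : ℝ => Real.exp (-t)) (Real.exp (-t) * (-1)) t :=
    (hasDerivAt_neg t).exp
  refine (h1.div (hasDerivAt_ouVar t) h).congr_deriv ?_
  unfold ouB ouC
  have h2 : Real.exp (-2 * t) = 1 - ouVar t := by unfold ouVar; ring
  rw [h2]
  field_simp
  ring

lemma contDiff_ouVar : ContDiff ℝ 1 ouVar := by unfold ouVar; fun_prop

lemma contDiffOn_ouC : ContDiffOn ℝ 1 ouC (Ioi 0) := by
  unfold ouC
  have := contDiff_ouVar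
  exact ContDiffOn.div (by fun_prop) (by fun_prop) fun t ht => by
    have := (ouVar_pos ht).ne'; positivity

lemma contDiffOn_ouB : ContDiffOn ℝ 1 ouB (Ioi 0) := by
  unfold ouB
  have := contDiff_ouVar
  exact ContDiffOn.div (by fun_prop) (by fun_prop) fun t ht => (ouVar_pos ht).ne'

end Coefficients

/-! ### The explicit velocity field, its divergence and the continuity equation. -/

section Velocity

variable {V : Type*} [NormedAddCommGroup V] [InnerProductSpace ℝ V] [FiniteDimensional ℝ V]
  [MeasurableSpace V] [BorelSpace V]

/-- The total mass of the tilted measure. -/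
def tiltMass (μ : Measure V) (p : V × ℝ) : ℝ := tilt μ (fun _ => (1 : ℝ)) p

/-- The mean of the normalized tilted measure. -/
def tiltMean (μ : Measure V) (p : V × ℝ) : V := (tiltMass μ p)⁻¹ • tilt μ (fun z => z) p

/-- The explicit form of the velocity field. -/
def flowField (μ : Measure V) (t : ℝ) (x : V) : V :=
  (2 * ouC t) • x - ouB t • tiltMean μ (ouB t • x, ouC t)

/-- The spatial derivative of the velocity field. -/
def flowFieldDeriv (μ : Measure V) (t : ℝ) (x : V) : V →L[ℝ] V :=
  (fderiv ℝ (Function.uncurry (flowField μ)) (t, x)).comp (ContinuousLinearMap.inr ℝ ℝ V)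

variable {μ : Measure V} [IsFiniteMeasure μ]

lemma tilt_smulRight_apply {F : Type*} [NormedAddCommGroup F] [NormedSpace ℝ F] [CompleteSpace F]
    {ψ : V → F} (hψ : PolyGrowth ψ) {p : V × ℝ} (hp : 0 < p.2) (q : V × ℝ) :
    tilt μ (fun z => (tiltForm z).smulRight (ψ z)) p q = tilt μ (fun z => tiltForm z q • ψ z) p := by
  rw [tilt, ContinuousLinearMap.integral_apply (hψ.smulRight.integrable hp)]
  simp [tilt]

variable [NeZero μ]

lemma tiltMass_pos {p : V × ℝ} (hp : 0 < p.2) : 0 < tiltMass μ p := tilt_one_pos hp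

/-- The tilt parameter `(ouB t • x, ouC t)` stays in the half-space of positive quadratic parameter.
Joint regularity in `(t, x)` is what gives constants uniform on compact time intervals and a
continuous linearised equation. -/
lemma contDiffOn_flowField :
    ContDiffOn ℝ 1 (Function.uncurry (flowField μ)) (Ioi 0 ×ˢ univ) := by
  have hB : ContDiffOn ℝ 1 (fun p : ℝ × V => ouB p.1) (Ioi 0 ×ˢ univ) :=
    contDiffOn_ouB.comp contDiffOn_fst fun p hp => hp.1
  have hC : ContDiffOn ℝ 1 (fun p : ℝ × V => ouC p.1) (Ioi 0 ×ˢ univ) :=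
    contDiffOn_ouC.comp contDiffOn_fst fun p hp => hp.1
  have hq : ContDiffOn ℝ 1 (fun p : ℝ × V => (ouB p.1 • p.2, ouC p.1)) (Ioi 0 ×ˢ univ) :=
    (hB.smul contDiffOn_snd).prodMk hC
  have h0 : ContDiffOn ℝ 1 (tiltMass μ) {p | 0 < p.2} := contDiffOn_tilt (PolyGrowth.const 1)
  have h1 : ContDiffOn ℝ 1 (tilt μ (fun z : V => z)) {p | 0 < p.2} := contDiffOn_tilt PolyGrowth.id
  have hm : ContDiffOn ℝ 1 (tiltMean μ) {p | 0 < p.2} :=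
    (h0.inv fun p hp => (tiltMass_pos hp).ne').smul h1
  exact ((contDiffOn_const.mul hC).smul contDiffOn_snd).sub
    (hB.smul (hm.comp hq fun p hp => ouC_pos hp.1))

lemma isOpen_Ioi_prod_univ : IsOpen (Ioi (0 : ℝ) ×ˢ (univ : Set V)) := isOpen_Ioi.prod isOpen_univ

lemma continuousOn_flowFieldDeriv :
    ContinuousOn (Function.uncurry (flowFieldDeriv μ)) (Ioi 0 ×ˢ univ) :=
  (contDiffOn_flowField.continuousOn_fderiv_of_isOpen isOpen_Ioi_prod_univ le_rfl).clm_comp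
    continuousOn_const

lemma hasFDerivAt_flowField {t : ℝ} (ht : 0 < t) (x : V) :
    HasFDerivAt (flowField μ t) (flowFieldDeriv μ t x) x := by
  have h : HasFDerivAt (Function.uncurry (flowField μ))
      (fderiv ℝ (Function.uncurry (flowField μ)) (t, x)) (t, x) :=
    ((contDiffOn_flowField.differentiableOn one_ne_zero).differentiableAt
      (isOpen_Ioi_prod_univ.mem_nhds (show (t, x) ∈ _ from ⟨ht, mem_univ x⟩))).hasFDerivAt
  exact h.comp x (hasFDerivAt_prodMk_right t x)

lemma continuousOn_flowField (x : V) : ContinuousOn (fun t => flowField μ t x) (Ioi 0) :=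
  contDiffOn_flowField.continuousOn.comp (continuousOn_id.prodMk continuousOn_const)
    fun _ ht => ⟨ht, mem_univ x⟩

lemma lipschitzOnWith_flowField {a b : ℝ} (ha : 0 < a) (R : ℝ) :
    ∃ K : ℝ≥0, ∀ t ∈ Icc a b, LipschitzOnWith K (flowField μ t) (closedBall 0 R) := by
  have hsub : Icc a b ×ˢ closedBall (0 : V) R ⊆ Ioi 0 ×ˢ univ :=
    prod_mono (fun t ht => ha.trans_le ht.1) (subset_univ _)
  obtain ⟨C, hC⟩ := (isCompact_Icc.prod (isCompact_closedBall (0 : V) R)).exists_bound_of_continuousOn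
    ((continuousOn_flowFieldDeriv (μ := μ)).mono hsub)
  refine ⟨Real.toNNReal C, fun t ht => ?_⟩
  refine (convex_closedBall (0 : V) R).lipschitzOnWith_of_nnnorm_hasFDerivWithin_le
    (fun x _ => (hasFDerivAt_flowField (ha.trans_le ht.1) x).hasFDerivWithinAt) fun x hx => ?_
  rw [← NNReal.coe_le_coe, coe_nnnorm]
  exact (hC (t, x) ⟨ht, hx⟩).trans (Real.le_coe_toNNReal C)

lemma hasFDerivAt_tiltMass {p : V × ℝ} (hp : 0 < p.2) :
    HasFDerivAt (tiltMass μ) (tilt μ (fun z => (tiltForm z).smulRight (1 : ℝ)) p) p :=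
  hasFDerivAt_tilt (PolyGrowth.const 1) hp

lemma polyGrowth_norm_sq : PolyGrowth (fun z : V => ‖z‖ ^ 2) :=
  ⟨by fun_prop, 1, 2, zero_le_one, fun z => by
    rw [norm_pow, norm_norm, one_mul]; gcongr; linarith⟩

lemma polyGrowth_inner_smul (w : V) : PolyGrowth (fun z : V => ⟪z, w⟫ • z) :=
  ⟨by fun_prop, ‖w‖, 2, norm_nonneg _, fun z => by
    rw [norm_smul]
    calc _ ≤ ‖z‖ * ‖w‖ * ‖z‖ := by gcongr; exact norm_inner_le_norm z w
      _ = ‖w‖ * ‖z‖ ^ 2 := by ring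
      _ ≤ _ := by gcongr; linarith⟩

omit [NeZero μ] in
lemma tiltMass_deriv_apply {p : V × ℝ} (hp : 0 < p.2) (q : V × ℝ) :
    tilt μ (fun z => (tiltForm z).smulRight (1 : ℝ)) p q =
      ⟪tilt μ (fun z => z) p, q.1⟫ - tilt μ (fun z => ‖z‖ ^ 2) p * q.2 := by
  have h1 := PolyGrowth.id.integrable (V := V) (μ := μ) hp
  have h2 := polyGrowth_norm_sq.integrable (V := V) (μ := μ) hp
  rw [tilt_smulRight_apply (PolyGrowth.const 1) hp, tilt, tilt, tilt, real_inner_comm,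
    ← integral_inner h1, ← integral_mul_const, ← integral_sub (h1.const_inner q.1) (h2.mul_const _)]
  refine integral_congr_ae (Eventually.of_forall fun z => ?_)
  simp only [tiltForm_apply, smul_eq_mul, mul_one, real_inner_smul_right, real_inner_comm z q.1]
  ring

/-- The derivative of the tilted mean in the linear parameter is the tilted covariance, the bracket
on the right. -/
lemma flowFieldDeriv_apply {t : ℝ} (ht : 0 < t) (x w : V) :
    flowFieldDeriv μ t x w = (2 * ouC t) • w - ouB t ^ 2 •
      ((tiltMass μ (ouB t • x, ouC t))⁻¹ • tilt μ (fun z => ⟪z, w⟫ • z) (ouB t • x, ouC t) -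
        ⟪tiltMean μ (ouB t • x, ouC t), w⟫ • tiltMean μ (ouB t • x, ouC t)) := by
  set p : V × ℝ := (ouB t • x, ouC t) with hp
  have hp0 : 0 < p.2 := ouC_pos ht
  have hm0 := tiltMass_pos (μ := μ) hp0
  have h0 := hasFDerivAt_tiltMass (μ := μ) hp0
  have h1 := hasFDerivAt_tilt (μ := μ) (PolyGrowth.id (V := V)) hp0
  have hmean : HasFDerivAt (tiltMean μ) _ p := ((hasDerivAt_inv hm0.ne').comp_hasFDerivAt p h0).smul h1
  have hq : HasFDerivAt (fun x : V => (ouB t • x, ouC t))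
      ((ouB t • ContinuousLinearMap.id ℝ V).prod (0 : V →L[ℝ] ℝ)) x :=
    ((hasFDerivAt_id x).const_smul (ouB t)).prodMk (hasFDerivAt_const _ x)
  have hV : HasFDerivAt (flowField μ t) _ x :=
    ((hasFDerivAt_id x).const_smul (2 * ouC t)).sub ((hmean.comp x hq).const_smul (ouB t))
  rw [(hasFDerivAt_flowField ht x).unique hV]
  simp [tiltMass_deriv_apply hp0, tilt_smulRight_apply PolyGrowth.id hp0]
  have hsm : tilt μ (fun z => ⟪z, ouB t • w⟫ • z) p = ouB t • tilt μ (fun z => ⟪z, w⟫ • z) p := by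
    simp only [tilt, real_inner_smul_right]
    rw [← integral_smul]
    refine integral_congr_ae (Eventually.of_forall fun z => ?_)
    simp only [smul_smul]
    congr 1; ring
  rw [hsm, tiltMean, real_inner_smul_left, real_inner_smul_right]
  module

/-- The divergence of the velocity field. -/
lemma trace_flowFieldDeriv {ι : Type*} [Fintype ι] (e : OrthonormalBasis ι ℝ V) {t : ℝ}
    (ht : 0 < t) (x : V) :
    ∑ i, ⟪e i, flowFieldDeriv μ t x (e i)⟫ = 2 * ouC t * Module.finrank ℝ V - ouB t ^ 2 *
      ((tiltMass μ (ouB t • x, ouC t))⁻¹ * tilt μ (fun z => ‖z‖ ^ 2) (ouB t • x, ouC t) -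
        ‖tiltMean μ (ouB t • x, ouC t)‖ ^ 2) := by
  set p : V × ℝ := (ouB t • x, ouC t) with hp
  have hp0 : 0 < p.2 := ouC_pos ht
  have hM : ∑ i, ⟪e i, tilt μ (fun z => ⟪z, e i⟫ • z) p⟫ = tilt μ (fun z => ‖z‖ ^ 2) p := by
    have hi : ∀ i, Integrable (fun z => Real.exp (tiltForm z p) • (⟪z, e i⟫ • z)) μ :=
      fun i => (polyGrowth_inner_smul (e i)).integrable hp0
    simp only [tilt, ← integral_inner (hi _)]
    rw [← integral_finsetSum _ fun i _ => (hi i).const_inner (e i)]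
    refine integral_congr_ae (Eventually.of_forall fun z => ?_)
    simp only [real_inner_smul_right, ← Finset.mul_sum, smul_eq_mul]
    rw [← e.sum_sq_inner_right z]
    congr 1
    exact Finset.sum_congr rfl fun i _ => by rw [real_inner_comm]; ring
  simp only [flowFieldDeriv_apply ht, inner_sub_right, real_inner_smul_right,
    Finset.sum_sub_distrib, ← Finset.mul_sum]
  rw [← hp, hM]
  have h1 : ∀ i, ⟪e i, e i⟫ = 1 := fun i => by
    rw [real_inner_self_eq_norm_sq, e.norm_eq_one, one_pow]
  rw [e.sum_inner_mul_inner, real_inner_self_eq_norm_sq, Finset.sum_congr rfl fun i _ => h1 i]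
  simp [Module.finrank_eq_card_basis e.toBasis]

/-- The logarithm of the density of the law at time `t` with respect to Lebesgue measure, up to
an additive constant. -/
def logDensity (μ : Measure V) (t : ℝ) (x : V) : ℝ :=
  -(1 / 2 + ouC t) * ‖x‖ ^ 2 - Module.finrank ℝ V / 2 * Real.log (ouVar t) +
    Real.log (tiltMass μ (ouB t • x, ouC t))

/-- The continuity equation along trajectories. -/
lemma hasDerivWithinAt_logDensity {ι : Type*} [Fintype ι] (e : OrthonormalBasis ι ℝ V) {t : ℝ}
    (ht : 0 < t) {γ : ℝ → V} {s : Set ℝ}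
    (hγ : HasDerivWithinAt γ (flowField μ t (γ t)) s t) :
    HasDerivWithinAt (fun τ => logDensity μ τ (γ τ))
      (-∑ i, ⟪e i, flowFieldDeriv μ t (γ t) (e i)⟫) s t := by
  set p : V × ℝ := (ouB t • γ t, ouC t) with hp
  have hp0 : 0 < p.2 := ouC_pos ht
  have hm0 := tiltMass_pos (μ := μ) hp0
  have hC := (hasDerivAt_ouC ht).hasDerivWithinAt (s := s)
  have hB := (hasDerivAt_ouB ht).hasDerivWithinAt (s := s)
  have hL := (hasDerivAt_log_ouVar ht).hasDerivWithinAt (s := s)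
  have hcurve := (hB.smul hγ).prodMk hC
  have hlog := ((hasFDerivAt_tiltMass (μ := μ) hp0).comp_hasDerivWithinAt t hcurve).log hm0.ne'
  have hmain := ((((hC.const_add (1 / 2)).fun_neg).mul hγ.norm_sq).sub
    (hL.const_mul (Module.finrank ℝ V / 2 : ℝ))).add hlog
  refine hmain.congr_deriv ?_
  rw [trace_flowFieldDeriv e ht, ← hp, tiltMass_deriv_apply hp0]
  have hmean : tilt μ (fun z => z) p = tiltMass μ p • tiltMean μ p := by
    rw [tiltMean, smul_inv_smul₀ hm0.ne']
  have hb := ouB_sq ht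
  have hV : flowField μ t (γ t) = (2 * ouC t) • γ t - ouB t • tiltMean μ p := rfl
  rw [hmean, hV]
  simp only [inner_sub_right, inner_add_right, real_inner_smul_right, real_inner_smul_left,
    real_inner_self_eq_norm_sq, Function.comp_apply]
  rw [real_inner_comm (tiltMean μ p) (γ t)]
  change _ + _ / tiltMass μ p = _
  field_simp
  -- The second moment and the squared mean match the divergence, and the mixed terms cancel through
  -- the derivative of `ouB`. Only the coefficient of `‖γ t‖²` remains, which vanishes by `ouB_sq`.
  linear_combination 2 * tiltMass μ p * ‖γ t‖ ^ 2 * hb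

end Velocity

/-! ### Lebesgue densities of Gaussian measures. -/

section Gaussian

variable {d : ℕ}

/-- The normalizing constant of the standard Gaussian density. -/
def gaussConst (d : ℕ) : ℝ := (Real.sqrt (2 * Real.pi) ^ d)⁻¹

lemma gaussConst_pos (d : ℕ) : 0 < gaussConst d := by
  unfold gaussConst; have := Real.pi_pos; positivity

/-- The density of the Gaussian measure with mean `m` and covariance `s² Id`. -/
def gaussDensity (s : ℝ) (m x : E d) : ℝ :=
  gaussConst d * (s ^ d)⁻¹ * Real.exp (-‖x - m‖ ^ 2 / (2 * s ^ 2))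

lemma gaussDensity_pos {s : ℝ} (hs : 0 < s) (m x : E d) : 0 < gaussDensity s m x := by
  unfold gaussDensity; have := gaussConst_pos d; positivity

lemma continuous_gaussDensity (s : ℝ) (m : E d) : Continuous (gaussDensity s m) := by
  unfold gaussDensity; fun_prop

lemma integrable_gaussDensity_one : Integrable (gaussDensity 1 (0 : E d)) := by
  have h := (GaussianFourier.integrable_cexp_neg_mul_sq_norm_add_of_euclideanSpace (ι := Fin d) (b := 1 / 2)
    (by norm_num) 0 0).re
  refine (h.const_mul (gaussConst d)).congr (Eventually.of_forall fun x => ?_)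
  have : (-(1 / 2 : ℂ) * (‖x‖ : ℂ) ^ 2 + 0 * ((⟪(0 : E d), x⟫ : ℝ) : ℂ)) =
      ((-‖x‖ ^ 2 / 2 : ℝ) : ℂ) := by push_cast; ring
  simp only [gaussDensity, this, RCLike.re_to_complex]
  rw [← Complex.ofReal_exp, Complex.ofReal_re]
  simp

/-- Both sides are finite measures, so it suffices to compare characteristic functions; the one on
the right is a Gaussian Fourier integral. -/
lemma gaussian_eq_withDensity :
    gaussian d = (volume : Measure (E d)).withDensity
      (fun x => ENNReal.ofReal (gaussDensity 1 0 x)) := by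
  have hfin : IsFiniteMeasure ((volume : Measure (E d)).withDensity
      (fun x => ENNReal.ofReal (gaussDensity 1 0 x))) :=
    isFiniteMeasure_withDensity_ofReal integrable_gaussDensity_one.2
  refine Measure.ext_of_charFun (funext fun t => ?_)
  rw [charFun_stdGaussian, charFun_apply, integral_withDensity_eq_integral_toReal_smul
    (by have := continuous_gaussDensity (1 : ℝ) (0 : E d); fun_prop)
    (Eventually.of_forall fun x => ENNReal.ofReal_lt_top)]
  have h := GaussianFourier.integral_cexp_neg_mul_sq_norm_add_of_euclideanSpace (ι := Fin d) (b := 1 / 2)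
    (by norm_num) Complex.I t
  have h2 : ∀ x : E d, (ENNReal.ofReal (gaussDensity 1 0 x)).toReal •
      Complex.exp (⟪x, t⟫ * Complex.I) = (gaussConst d : ℂ) *
        Complex.exp (-(1 / 2) * ‖x‖ ^ 2 + Complex.I * ⟪t, x⟫) := by
    intro x
    rw [ENNReal.toReal_ofReal (gaussDensity_pos one_pos 0 x).le, gaussDensity, Complex.real_smul,
      Complex.exp_add, real_inner_comm]
    push_cast
    simp only [one_pow, inv_one, mul_one, sub_zero, mul_assoc]
    congr 3
    · ring
    · ring
  simp only [h2]
  rw [integral_const_mul, h]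
  have h3 : (Real.pi / (1 / 2 : ℂ)) ^ (Fintype.card (Fin d) / 2 : ℂ) =
      ((Real.sqrt (2 * Real.pi) ^ d : ℝ) : ℂ) := by
    have hpi : (0 : ℝ) ≤ 2 * Real.pi := by positivity
    rw [Fintype.card_fin, show (Real.pi / (1 / 2) : ℂ) = ((2 * Real.pi : ℝ) : ℂ) by push_cast; ring,
      Real.sqrt_eq_rpow, ← Real.rpow_natCast, ← Real.rpow_mul hpi, Complex.ofReal_cpow hpi]
    congr 1
    push_cast; ring
  rw [h3, ← mul_assoc, ← Complex.ofReal_mul, gaussConst, inv_mul_cancel₀ (by positivity)]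
  simp only [Complex.I_sq]
  rw [Complex.ofReal_one, one_mul]
  congr 1
  ring

lemma lintegral_comp_affine {s : ℝ} (hs : 0 < s) (m : E d) (f : E d → ℝ≥0∞) :
    ∫⁻ x, f x = ∫⁻ y, ENNReal.ofReal (s ^ d) * f (m + s • y) := by
  have hder : ∀ y ∈ (univ : Set (E d)), HasFDerivWithinAt (fun y => m + s • y)
      (s • ContinuousLinearMap.id ℝ (E d)) univ y := fun y _ =>
    (((hasFDerivAt_id y).const_smul s).const_add m).hasFDerivWithinAt
  have hinj : InjOn (fun y : E d => m + s • y) univ := fun y _ z _ h =>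
    smul_right_injective _ hs.ne' (add_left_cancel h)
  have := lintegral_image_eq_lintegral_abs_det_fderiv_mul volume MeasurableSet.univ hder hinj f
  have himg : (fun y : E d => m + s • y) '' univ = univ := by
    rw [image_univ, range_eq_univ]
    exact fun x => ⟨s⁻¹ • (x - m), by simp [smul_inv_smul₀ hs.ne']⟩
  rw [himg, setLIntegral_univ, setLIntegral_univ] at this
  rw [this]
  have hdet : (s • ContinuousLinearMap.id ℝ (E d)).det = s ^ d := by
    rw [ContinuousLinearMap.det]
    simp
  simp only [hdet, abs_of_pos (pow_pos hs d)]

lemma measurableEmbedding_affine {s : ℝ} (hs : 0 < s) (m : E d) :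
    MeasurableEmbedding (fun y : E d => m + s • y) :=
  ((Homeomorph.smulOfNeZero s hs.ne').trans (Homeomorph.addLeft m)).measurableEmbedding

lemma map_affine_gaussian {s : ℝ} (hs : 0 < s) (m : E d) :
    (gaussian d).map (fun y => m + s • y) = (volume : Measure (E d)).withDensity
      (fun x => ENNReal.ofReal (gaussDensity s m x)) := by
  have hg : ∀ (s : ℝ) (m : E d), Measurable fun x => ENNReal.ofReal (gaussDensity s m x) :=
    fun s m => by have := continuous_gaussDensity s m; fun_prop
  refine Measure.ext_of_lintegral _ fun f hf => ?_
  rw [lintegral_map hf (by fun_prop), gaussian_eq_withDensity,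
    lintegral_withDensity_eq_lintegral_mul _ (hg _ _) (by fun_prop),
    lintegral_withDensity_eq_lintegral_mul _ (hg _ _) hf]
  conv_rhs => rw [lintegral_comp_affine hs m]
  refine lintegral_congr fun y => ?_
  simp only [Pi.mul_apply]
  rw [← mul_assoc, ← ENNReal.ofReal_mul (by positivity)]
  congr 2
  unfold gaussDensity
  rw [add_sub_cancel_left, norm_smul, Real.norm_of_nonneg hs.le, sub_zero]
  field_simp
  rw [one_pow, mul_one]

end Gaussian

/-! ### Mehler's formula and the Ornstein–Uhlenbeck laws. -/

section Kernel

variable {d : ℕ} {μ : Measure (E d)} [IsProbabilityMeasure μ]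

lemma exp_neg_sq_eq (t : ℝ) : Real.exp (-t) ^ 2 = 1 - ouVar t := by
  rw [← exp_neg_two_mul]; unfold ouVar; ring

lemma sqrt_ouVar_pos {t : ℝ} (ht : 0 < t) : 0 < Real.sqrt (ouVar t) := Real.sqrt_pos.2 (ouVar_pos ht)

lemma sq_sqrt_ouVar {t : ℝ} (ht : 0 < t) : Real.sqrt (ouVar t) ^ 2 = ouVar t :=
  Real.sq_sqrt (ouVar_pos ht).le

/-- The exponent of the Mehler kernel. -/
lemma mehler_exponent {t : ℝ} (ht : 0 < t) (x z : E d) :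
    -‖x - Real.exp (-t) • z‖ ^ 2 / (2 * Real.sqrt (ouVar t) ^ 2) =
      -(1 / 2 + ouC t) * ‖x‖ ^ 2 + tiltForm z (ouB t • x, ouC t) := by
  have h := (ouVar_pos ht).ne'
  rw [sq_sqrt_ouVar ht, norm_sub_sq_real, norm_smul, Real.norm_of_nonneg (Real.exp_pos _).le,
    mul_pow, exp_neg_sq_eq, tiltForm_apply, real_inner_smul_right, real_inner_smul_right,
    real_inner_comm z x, ouC, ouB, exp_neg_two_mul, exp_neg_sq_eq]
  field_simp
  ring

/-- The same square with `x` and `z` exchanged: here the standard Gaussian weight in `z` is split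
off, as needed for `Q_t f`; `mehler_exponent` serves the density of the law at time `t`. -/
lemma mehler_exponent' {t : ℝ} (ht : 0 < t) (x z : E d) :
    -‖z - Real.exp (-t) • x‖ ^ 2 / (2 * Real.sqrt (ouVar t) ^ 2) =
      -‖z‖ ^ 2 / 2 - ouC t * ‖x‖ ^ 2 + tiltForm z (ouB t • x, ouC t) := by
  have h := (ouVar_pos ht).ne'
  rw [sq_sqrt_ouVar ht, norm_sub_sq_real, norm_smul, Real.norm_of_nonneg (Real.exp_pos _).le,
    mul_pow, exp_neg_sq_eq, tiltForm_apply, real_inner_smul_right, real_inner_smul_right,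
    ouC, ouB, exp_neg_two_mul, exp_neg_sq_eq]
  field_simp
  ring

/-- The noise has a Lebesgue density centred at `e^{-t} x`. Extracting the density of `γ_d` from it
recombines `f dγ_d` into `μ`, leaving an exponential tilt; absolute continuity is used here. -/
lemma ornsteinUhlenbeck_gaussianDensity (hμ : μ ≪ gaussian d) {t : ℝ} (ht : 0 < t) (x : E d) :
    ornsteinUhlenbeck t (gaussianDensity μ) x =
      (Real.sqrt (ouVar t) ^ d)⁻¹ * Real.exp (-ouC t * ‖x‖ ^ 2) *
        tiltMass μ (ouB t • x, ouC t) := by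
  have hs := sqrt_ouVar_pos ht
  have hg : ∀ (s : ℝ) (m : E d), Measurable fun x => ENNReal.ofReal (gaussDensity s m x) :=
    fun s m => by have := continuous_gaussDensity s m; fun_prop
  have h1 : ornsteinUhlenbeck t (gaussianDensity μ) x =
      ∫ z, gaussDensity (Real.sqrt (ouVar t)) (Real.exp (-t) • x) z * gaussianDensity μ z := by
    change ∫ y, gaussianDensity μ (Real.exp (-t) • x + Real.sqrt (ouVar t) • y) ∂gaussian d = _
    rw [← (measurableEmbedding_affine hs (Real.exp (-t) • x)).integral_map (gaussianDensity μ),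
      map_affine_gaussian hs, integral_withDensity_eq_integral_toReal_smul (hg _ _)
        (Eventually.of_forall fun x => ENNReal.ofReal_lt_top)]
    refine integral_congr_ae (Eventually.of_forall fun z => ?_)
    simp only [ENNReal.toReal_ofReal (gaussDensity_pos hs _ _).le, smul_eq_mul]
  have : μ.HaveLebesgueDecomposition (gaussian d) :=
    Measure.haveLebesgueDecomposition_of_sigmaFinite _ _
  rw [h1, tiltMass, tilt, ← integral_rnDeriv_smul (μ := μ) (ν := gaussian d) hμ, ← integral_const_mul]
  conv_rhs => rw [gaussian_eq_withDensity]
  rw [integral_withDensity_eq_integral_toReal_smul (hg _ _)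
        (Eventually.of_forall fun x => ENNReal.ofReal_lt_top), ← gaussian_eq_withDensity]
  refine integral_congr_ae (Eventually.of_forall fun z => ?_)
  have hkey : gaussDensity (Real.sqrt (ouVar t)) (Real.exp (-t) • x) z = gaussDensity 1 0 z *
      ((Real.sqrt (ouVar t) ^ d)⁻¹ * Real.exp (-ouC t * ‖x‖ ^ 2) *
        Real.exp (tiltForm z (ouB t • x, ouC t))) := by
    have h2 : -‖z‖ ^ 2 / 2 - ouC t * ‖x‖ ^ 2 + tiltForm z (ouB t • x, ouC t) =
        -‖z - 0‖ ^ 2 / (2 * 1 ^ 2) + -ouC t * ‖x‖ ^ 2 + tiltForm z (ouB t • x, ouC t) := by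
      rw [sub_zero]; ring
    rw [gaussDensity, mehler_exponent' ht, h2, Real.exp_add, Real.exp_add, gaussDensity]
    ring
  simp only [ENNReal.toReal_ofReal (gaussDensity_pos one_pos _ _).le, smul_eq_mul, gaussianDensity,
    hkey, mul_one]
  ring

lemma velocity_eq_flowField (hμ : μ ≪ gaussian d) {t : ℝ} (ht : 0 < t) (x : E d) :
    velocity μ t x = flowField μ t x := by
  have hfun : (fun z => Real.log (ornsteinUhlenbeck t (gaussianDensity μ) z)) =
      fun z => (Real.log (Real.sqrt (ouVar t) ^ d)⁻¹ + -ouC t * ‖z‖ ^ 2) +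
        Real.log (tiltMass μ (ouB t • z, ouC t)) := by
    funext z
    have h1 := tiltMass_pos (μ := μ) (p := (ouB t • z, ouC t)) (ouC_pos ht)
    have hs := sqrt_ouVar_pos ht
    rw [ornsteinUhlenbeck_gaussianDensity hμ ht, Real.log_mul (by positivity) h1.ne',
      Real.log_mul (by positivity) (by positivity), Real.log_exp]
  rw [velocity, hfun]
  set p : E d × ℝ := (ouB t • x, ouC t) with hp
  have hp0 : 0 < p.2 := ouC_pos ht
  have hm0 := tiltMass_pos (μ := μ) hp0
  have hq : HasFDerivAt (fun x : E d => (ouB t • x, ouC t))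
      ((ouB t • ContinuousLinearMap.id ℝ (E d)).prod (0 : E d →L[ℝ] ℝ)) x :=
    ((hasFDerivAt_id x).const_smul (ouB t)).prodMk (hasFDerivAt_const _ x)
  have hlog := ((hasFDerivAt_tiltMass (μ := μ) hp0).comp x hq).log hm0.ne'
  have hsq := (((hasStrictFDerivAt_norm_sq x).hasFDerivAt.const_mul (-ouC t)).const_add
      (Real.log (Real.sqrt (ouVar t) ^ d)⁻¹)).add hlog
  have hgrad : HasGradientAt (fun z => (Real.log (Real.sqrt (ouVar t) ^ d)⁻¹ + -ouC t * ‖z‖ ^ 2) +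
      Real.log (tiltMass μ (ouB t • z, ouC t))) (-flowField μ t x) x := by
    rw [hasGradientAt_iff_hasFDerivAt]
    refine hsq.congr_fderiv (ContinuousLinearMap.ext fun w => ?_)
    have hmean : tilt μ (fun z => z) p = tiltMass μ p • tiltMean μ p := by
      rw [tiltMean, smul_inv_smul₀ hm0.ne']
    have hcomp : ((tilt μ fun _ => (1 : ℝ)) ∘ fun x => (ouB t • x, ouC t)) x = tiltMass μ p := rfl
    rw [hcomp]
    simp only [_root_.add_apply, _root_.smul_apply,
      ContinuousLinearMap.comp_apply, ContinuousLinearMap.prod_apply, ← hp,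
      tiltMass_deriv_apply hp0, hmean, flowField, InnerProductSpace.toDual_apply_apply,
      inner_neg_left, inner_sub_left, real_inner_smul_left, ContinuousLinearMap.id_apply,
      innerSL_apply_apply, smul_eq_mul, _root_.zero_apply, real_inner_smul_right]
    field_simp
    simp
    ring
  rw [hgrad.gradient, neg_neg]

/-- The law of `e^{-t} X + √(1 - e^{-2t}) Y`, with `X ∼ μ` and `Y` standard Gaussian
independent. -/
def ouLaw (μ : Measure (E d)) (t : ℝ) : Measure (E d) :=
  (μ.prod (gaussian d)).map (fun p => Real.exp (-t) • p.1 + Real.sqrt (ouVar t) • p.2)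

instance (t : ℝ) : IsProbabilityMeasure (ouLaw μ t) :=
  Measure.isProbabilityMeasure_map (by fun_prop)

lemma lintegral_gaussDensity_eq {t : ℝ} (ht : 0 < t) (x : E d) :
    ∫⁻ z, ENNReal.ofReal (gaussDensity (Real.sqrt (ouVar t)) (Real.exp (-t) • z) x) ∂μ =
      ENNReal.ofReal (gaussConst d * Real.exp (logDensity μ t x)) := by
  have hs := sqrt_ouVar_pos ht
  have hp0 : 0 < (ouB t • x, ouC t).2 := ouC_pos ht
  have hm0 := tiltMass_pos (μ := μ) hp0
  have hform : ∀ z, gaussDensity (Real.sqrt (ouVar t)) (Real.exp (-t) • z) x =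
      gaussConst d * (Real.sqrt (ouVar t) ^ d)⁻¹ * Real.exp (-(1 / 2 + ouC t) * ‖x‖ ^ 2) *
        (Real.exp (tiltForm z (ouB t • x, ouC t)) • (1 : ℝ)) := fun z => by
    rw [gaussDensity, mehler_exponent ht, Real.exp_add, smul_eq_mul, mul_one]; ring
  have hint : Integrable (fun z => gaussDensity (Real.sqrt (ouVar t)) (Real.exp (-t) • z) x) μ := by
    simp only [hform]
    exact ((PolyGrowth.const (1 : ℝ)).integrable hp0).const_mul _
  rw [← ofReal_integral_eq_lintegral_ofReal hint
    (Eventually.of_forall fun z => (gaussDensity_pos hs _ _).le)]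
  congr 1
  simp only [hform]
  rw [integral_const_mul]
  change _ * tiltMass μ (ouB t • x, ouC t) = _
  rw [logDensity, Real.exp_add, Real.exp_log hm0, Real.exp_sub, finrank_euclideanSpace_fin]
  have : Real.exp (d / 2 * Real.log (ouVar t)) = Real.sqrt (ouVar t) ^ d := by
    rw [Real.sqrt_eq_rpow, ← Real.rpow_natCast, ← Real.rpow_mul (ouVar_pos ht).le,
      Real.rpow_def_of_pos (ouVar_pos ht)]
    congr 1; ring
  rw [this]
  field_simp

lemma lintegral_affine_gaussian {s : ℝ} (hs : 0 < s) (m : E d) {f : E d → ℝ≥0∞}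
    (hf : Measurable f) : ∫⁻ y, f (m + s • y) ∂gaussian d =
      ∫⁻ x, ENNReal.ofReal (gaussDensity s m x) * f x := by
  have hg : Measurable fun x => ENNReal.ofReal (gaussDensity s m x) := by
    have := continuous_gaussDensity s m; fun_prop
  rw [← lintegral_map (f := f) (g := fun y => m + s • y) hf (by fun_prop),
    map_affine_gaussian hs, lintegral_withDensity_eq_lintegral_mul _ hg hf]
  rfl

lemma measurable_gaussDensity_kernel (a s : ℝ) : Measurable (fun p : E d × E d =>
      ENNReal.ofReal (gaussDensity s (a • p.1) p.2)) := by
  unfold gaussDensity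
  fun_prop

lemma lintegral_ouLaw_eq_prod (t : ℝ) {f : E d → ℝ≥0∞} (hf : Measurable f) :
    ∫⁻ x, f x ∂ouLaw μ t =
      ∫⁻ z, ∫⁻ y, f (Real.exp (-t) • z + Real.sqrt (ouVar t) • y) ∂gaussian d ∂μ := by
  have hm : Measurable (fun p : E d × E d => Real.exp (-t) • p.1 + Real.sqrt (ouVar t) • p.2) := by
    fun_prop
  rw [ouLaw, lintegral_map hf hm]
  exact lintegral_prod _ (hf.comp hm).aemeasurable

lemma lintegral_kernel_swap {α : Type*} [MeasurableSpace α] (μ ν : Measure α) [SFinite μ]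
    [SFinite ν] {K : α × α → ℝ≥0∞} (hK : Measurable K) {f : α → ℝ≥0∞} (hf : Measurable f) :
    ∫⁻ z, ∫⁻ x, K (z, x) * f x ∂ν ∂μ = ∫⁻ x, (∫⁻ z, K (z, x) ∂μ) * f x ∂ν := by
  rw [lintegral_lintegral_swap (hK.mul (hf.comp measurable_snd)).aemeasurable]
  exact lintegral_congr fun x =>
    lintegral_mul_const (f x) (hK.comp (measurable_id.prodMk measurable_const))

lemma lintegral_ouLaw {t : ℝ} (ht : 0 < t) {f : E d → ℝ≥0∞} (hf : Measurable f) :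
    ∫⁻ x, f x ∂ouLaw μ t = ∫⁻ x, (∫⁻ z, ENNReal.ofReal
      (gaussDensity (Real.sqrt (ouVar t)) (Real.exp (-t) • z) x) ∂μ) * f x := by
  rw [lintegral_ouLaw_eq_prod t hf]
  simp only [lintegral_affine_gaussian (sqrt_ouVar_pos ht) _ hf]
  exact lintegral_kernel_swap μ volume
    (measurable_gaussDensity_kernel (Real.exp (-t)) (Real.sqrt (ouVar t))) hf

lemma ouLaw_eq_withDensity {t : ℝ} (ht : 0 < t) :
    ouLaw μ t = (volume : Measure (E d)).withDensity
      (fun x => ENNReal.ofReal (gaussConst d * Real.exp (logDensity μ t x))) := by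
  have hkm := measurable_gaussDensity_kernel (d := d) (Real.exp (-t)) (Real.sqrt (ouVar t))
  have hmeas : Measurable fun x => ENNReal.ofReal (gaussConst d * Real.exp (logDensity μ t x)) := by
    -- Measurability is read off from the kernel integral.
    simp only [← lintegral_gaussDensity_eq ht]
    exact hkm.lintegral_prod_left'
  refine Measure.ext_of_lintegral _ fun f hf => ?_
  rw [lintegral_ouLaw ht hf, lintegral_withDensity_eq_lintegral_mul _ hmeas hf]
  simp only [lintegral_gaussDensity_eq ht]
  rfl

end Kernel

/-! ### Completing the square for a semi-log-convex measure. -/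

section SemiLogConvex

variable {d : ℕ} {μ : Measure (E d)} [IsProbabilityMeasure μ]

/-- The variance of the law at time `t` in the extremal Gaussian case, multiplied by `β`. -/
def ouK (β t : ℝ) : ℝ := Real.exp (-2 * t) + β * ouVar t

/-- The standard deviation `√((1 - e^{-2t}) / ouK β t)`. -/
def ouTau (β t : ℝ) : ℝ := Real.sqrt (ouVar t / ouK β t)

lemma ouK_pos {β : ℝ} (hβ : 0 < β) {t : ℝ} (ht : 0 ≤ t) : 0 < ouK β t := by
  have h : 0 ≤ ouVar t := by
    unfold ouVar; rw [sub_nonneg, Real.exp_le_one_iff]; linarith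
  unfold ouK; positivity

lemma ouTau_pos {β : ℝ} (hβ : 0 < β) {t : ℝ} (ht : 0 < t) : 0 < ouTau β t :=
  Real.sqrt_pos.2 (div_pos (ouVar_pos ht) (ouK_pos hβ ht.le))

/-- The convolution of `exp φ` with the Gaussian measure of covariance `τ² Id`. -/
def heatConv (φ : E d → ℝ) (τ : ℝ) (y : E d) : ℝ := ∫ w, Real.exp (φ (y + τ • w)) ∂gaussian d

/-- `μ` has density `exp (φ - β ‖x‖² / 2)` with `φ` continuous. -/
def HasPotential (β : ℝ) (φ : E d → ℝ) (μ : Measure (E d)) : Prop :=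
  Continuous φ ∧ μ = (volume : Measure (E d)).withDensity
    (fun x => ENNReal.ofReal (Real.exp (φ x - β / 2 * ‖x‖ ^ 2)))

/-- The total coefficient of `‖z‖²` is `β / 2 + ouC t = ouK β t / (2 * ouVar t)`, which gives the
variance `ouTau²`. The centre is `ouB t * ouTau²` times `x`. -/
lemma tilt_kernel_eq {β : ℝ} (hβ : 0 < β) {t : ℝ} (ht : 0 < t) (φ : E d → ℝ) (x z : E d) :
    Real.exp (φ z - β / 2 * ‖z‖ ^ 2) * Real.exp (tiltForm z (ouB t • x, ouC t)) =
      (gaussConst d)⁻¹ * ouTau β t ^ d *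
        Real.exp (Real.exp (-2 * t) * ‖x‖ ^ 2 / (2 * ouK β t * ouVar t)) *
        (gaussDensity (ouTau β t) ((Real.exp (-t) / ouK β t) • x) z * Real.exp (φ z)) := by
  have hτ := ouTau_pos hβ ht
  have hk := ouK_pos hβ ht.le
  have hv := ouVar_pos ht
  have hc := gaussConst_pos d
  rw [gaussDensity, ← Real.exp_add]
  have h2 : ouTau β t ^ 2 = ouVar t / ouK β t := Real.sq_sqrt (by positivity)
  have : ∀ A B C G T : ℝ, G ≠ 0 → T ≠ 0 →
      G⁻¹ * T * Real.exp A * (G * T⁻¹ * Real.exp B * Real.exp C) = Real.exp (A + B + C) := by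
    intro A B C G T hG hT
    rw [Real.exp_add, Real.exp_add]; field_simp
  rw [this _ _ _ _ _ hc.ne' (by positivity)]
  congr 1
  have hke : ouK β t = Real.exp (-t) ^ 2 + β * ouVar t := by rw [ouK, exp_neg_two_mul]
  rw [h2, norm_sub_sq_real, norm_smul, Real.norm_of_nonneg (by positivity), tiltForm_apply,
    real_inner_smul_right, real_inner_smul_right, ouC, ouB, exp_neg_two_mul]
  field_simp
  rw [hke]
  ring

/-- Finiteness of `μ` alone controls the growth of `φ`: the tilt of `μ` is integrable, and by
`tilt_kernel_eq` it is this Gaussian integral once `x` is chosen so that the centre is `y`. -/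
lemma HasPotential.integrable_exp {β : ℝ} (hβ : 0 < β) {φ : E d → ℝ} (h : HasPotential β φ μ)
    {t : ℝ} (ht : 0 < t) (y : E d) :
    Integrable (fun w => Real.exp (φ (y + ouTau β t • w))) (gaussian d) := by
  have hτ := ouTau_pos hβ ht
  have hk := ouK_pos hβ ht.le
  have hg : ∀ (s : ℝ) (m : E d), Measurable fun x => ENNReal.ofReal (gaussDensity s m x) :=
    fun s m => by have := continuous_gaussDensity s m; fun_prop
  have hφ := h.1
  set x : E d := (ouK β t / Real.exp (-t)) • y with hx
  have hxy : (Real.exp (-t) / ouK β t) • x = y := by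
    rw [hx, smul_smul]
    have : Real.exp (-t) / ouK β t * (ouK β t / Real.exp (-t)) = 1 := by field_simp
    rw [this, one_smul]
  have h1 : Integrable (fun z => Real.exp (tiltForm z (ouB t • x, ouC t)) • (1 : ℝ)) μ :=
    (PolyGrowth.const (1 : ℝ)).integrable (ouC_pos ht)
  rw [h.2, integrable_withDensity_iff_integrable_smul' (by fun_prop)
    (Eventually.of_forall fun x => ENNReal.ofReal_lt_top)] at h1
  simp only [ENNReal.toReal_ofReal (Real.exp_pos _).le, smul_eq_mul, mul_one,
    tilt_kernel_eq hβ ht φ x, hxy] at h1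
  have hne : (gaussConst d)⁻¹ * ouTau β t ^ d *
        Real.exp (Real.exp (-2 * t) * ‖x‖ ^ 2 / (2 * ouK β t * ouVar t)) ≠ 0 := by
    have := gaussConst_pos d; positivity
  rw [integrable_const_mul_iff (isUnit_iff_ne_zero.2 hne)] at h1
  refine ((measurableEmbedding_affine hτ y).integrable_map_iff
    (g := fun z => Real.exp (φ z))).1 ?_
  rw [map_affine_gaussian hτ, integrable_withDensity_iff_integrable_smul' (hg _ _)
    (Eventually.of_forall fun x => ENNReal.ofReal_lt_top)]
  simpa only [ENNReal.toReal_ofReal (gaussDensity_pos hτ _ _).le, smul_eq_mul] using h1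

lemma HasPotential.tiltMass_eq {β : ℝ} (hβ : 0 < β) {φ : E d → ℝ} (h : HasPotential β φ μ)
    {t : ℝ} (ht : 0 < t) (x : E d) :
    tiltMass μ (ouB t • x, ouC t) = (gaussConst d)⁻¹ * ouTau β t ^ d *
        Real.exp (Real.exp (-2 * t) * ‖x‖ ^ 2 / (2 * ouK β t * ouVar t)) *
        heatConv φ (ouTau β t) ((Real.exp (-t) / ouK β t) • x) := by
  have hτ := ouTau_pos hβ ht
  have hg : ∀ (s : ℝ) (m : E d), Measurable fun x => ENNReal.ofReal (gaussDensity s m x) :=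
    fun s m => by have := continuous_gaussDensity s m; fun_prop
  have hφ := h.1
  conv_lhs => rw [h.2]
  rw [tiltMass, tilt, integral_withDensity_eq_integral_toReal_smul (by fun_prop)
    (Eventually.of_forall fun x => ENNReal.ofReal_lt_top), heatConv,
    ← (measurableEmbedding_affine hτ _).integral_map (fun z => Real.exp (φ z)),
    map_affine_gaussian hτ, integral_withDensity_eq_integral_toReal_smul (hg _ _)
      (Eventually.of_forall fun x => ENNReal.ofReal_lt_top), ← integral_const_mul]
  refine integral_congr_ae (Eventually.of_forall fun z => ?_)
  simp only [ENNReal.toReal_ofReal (gaussDensity_pos hτ _ _).le,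
    ENNReal.toReal_ofReal (Real.exp_pos _).le, smul_eq_mul, mul_one]
  exact tilt_kernel_eq hβ ht φ x z

end SemiLogConvex

/-- The gradient inequality for differentiable convex functions. -/
lemma convexOn_gradient_inequality {V : Type*} [NormedAddCommGroup V] [NormedSpace ℝ V] {g : V → ℝ}
    (hg : ConvexOn ℝ univ g) {x : V} {g' : V →L[ℝ] ℝ} (h : HasFDerivAt g g' x) (u : V) :
    g' u ≤ g (x + u) - g x := by
  have hline : ConvexOn ℝ univ (fun t : ℝ => g (x + t • u)) :=
    (hg.translate_right x).comp_linearMap (LinearMap.toSpanSingleton ℝ V u)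
  have hd : HasDerivAt (fun t : ℝ => g (x + t • u)) (g' u) 0 := by
    have h2 : HasDerivAt (fun t : ℝ => x + t • u) u 0 := by
      simpa using ((hasDerivAt_id (0 : ℝ)).smul_const u).const_add x
    have h3 : HasFDerivAt g g' (x + (0 : ℝ) • u) := by simpa using h
    exact h3.comp_hasDerivAt (0 : ℝ) h2
  have := hline.le_slope_of_hasDerivAt (mem_univ 0) (mem_univ 1) one_pos hd
  simpa [slope_def_field] using this

/-! ### Monotonicity and log-convexity of Gaussian convolutions. -/

section HeatConv

variable {d : ℕ} {φ : E d → ℝ}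

lemma integral_gaussian_comp_neg (f : E d → ℝ) :
    ∫ w, f (-w) ∂gaussian d = ∫ w, f w ∂gaussian d := by
  have h := stdGaussian_map (E := E d) (F := E d) (LinearIsometryEquiv.neg ℝ)
  conv_rhs => rw [gaussian, ← h]
  exact ((LinearIsometryEquiv.neg ℝ (E := E d)).toHomeomorph.measurableEmbedding.integral_map
    f).symm

lemma heatConv_zero (y : E d) : heatConv φ 0 y = Real.exp (φ y) := by
  simp [heatConv]

lemma heatConv_pos {τ : ℝ} {y : E d}
    (hint : Integrable (fun w => Real.exp (φ (y + τ • w))) (gaussian d)) :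
    0 < heatConv φ τ y := by
  rw [heatConv, integral_pos_iff_support_of_nonneg (fun w => (Real.exp_pos _).le) hint]
  have : Function.support (fun w => Real.exp (φ (y + τ • w))) = univ := by
    ext w; simp [(Real.exp_pos _).ne']
  rw [this, measure_univ]
  exact one_pos

/-- The point `y + σ • w` is a convex combination of `y + τ • w` and `y - τ • w` with weight `(1 + σ
/ τ) / 2`, and the Gaussian is symmetric. -/
lemma heatConv_mono (hφ : ConvexOn ℝ univ φ) {σ τ : ℝ} (hσ : 0 ≤ σ) (hστ : σ ≤ τ) {y : E d}
    (hint : Integrable (fun w => Real.exp (φ (y + τ • w))) (gaussian d)) :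
    heatConv φ σ y ≤ heatConv φ τ y := by
  rcases hστ.eq_or_lt with rfl | hlt
  · exact le_rfl
  have hτ : 0 < τ := hσ.trans_lt hlt
  have hint' : Integrable (fun w => Real.exp (φ (y + τ • (-w)))) (gaussian d) := by
    have h := stdGaussian_map (E := E d) (F := E d) (LinearIsometryEquiv.neg ℝ)
    rw [gaussian, ← h] at hint
    exact ((LinearIsometryEquiv.neg ℝ (E := E d)).toHomeomorph.measurableEmbedding.integrable_map_iff
      (g := fun w => Real.exp (φ (y + τ • w)))).1 hint
  set r : ℝ := (1 + σ / τ) / 2 with hr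
  have hr0 : 0 ≤ r := by positivity
  have hr1 : 0 ≤ 1 - r := by
    have : σ / τ ≤ 1 := (div_le_one hτ).2 hστ
    rw [hr]; linarith
  have hexp : ConvexOn ℝ univ (fun x => Real.exp (φ x)) :=
    ⟨convex_univ, fun x hx y hy a b ha hb hab => (Real.exp_le_exp.2 (hφ.2 hx hy ha hb hab)).trans
      (convexOn_exp.2 (mem_univ _) (mem_univ _) ha hb hab)⟩
  have hpt : ∀ w : E d, Real.exp (φ (y + σ • w)) ≤
      r * Real.exp (φ (y + τ • w)) + (1 - r) * Real.exp (φ (y + τ • (-w))) := by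
    intro w
    have := hexp.2 (mem_univ (y + τ • w)) (mem_univ (y + τ • (-w))) hr0 hr1 (by ring)
    have harg : r • (y + τ • w) + (1 - r) • (y + τ • (-w)) = y + σ • w := by
      have : σ = r * τ - (1 - r) * τ := by rw [hr]; field_simp; ring
      rw [this]; module
    simpa only [harg, smul_eq_mul] using this
  calc heatConv φ σ y ≤ ∫ w, (r * Real.exp (φ (y + τ • w)) +
        (1 - r) * Real.exp (φ (y + τ • (-w)))) ∂gaussian d :=
        integral_mono_of_nonneg (Eventually.of_forall fun w => (Real.exp_pos _).le)
          ((hint.const_mul _).add (hint'.const_mul _)) (Eventually.of_forall hpt)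
    _ = heatConv φ τ y := by
      rw [integral_add (hint.const_mul _) (hint'.const_mul _), integral_const_mul,
        integral_const_mul, integral_gaussian_comp_neg (fun w => Real.exp (φ (y + τ • w))), heatConv]
      ring

/-- Hölder's inequality, proved directly: after normalising the two integrands to total mass one,
the convexity of `exp` is applied pointwise and integrated. -/
lemma convexOn_log_heatConv (hφ : ConvexOn ℝ univ φ) {τ : ℝ}
    (hint : ∀ y, Integrable (fun w => Real.exp (φ (y + τ • w))) (gaussian d)) :
    ConvexOn ℝ univ (fun y => Real.log (heatConv φ τ y)) := by
  refine ⟨convex_univ, fun x _ y _ a b ha hb hab => ?_⟩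
  have hx := heatConv_pos (hint x)
  have hy := heatConv_pos (hint y)
  rw [Real.log_le_iff_le_exp (heatConv_pos (hint _))]
  set A := Real.log (heatConv φ τ x) with hA
  set B := Real.log (heatConv φ τ y) with hB
  have hpt : ∀ w, Real.exp (φ (a • x + b • y + τ • w)) ≤ Real.exp (a • A + b • B) *
      (a * (Real.exp (-A) * Real.exp (φ (x + τ • w))) +
        b * (Real.exp (-B) * Real.exp (φ (y + τ • w)))) := by
    intro w
    have h1 := hφ.2 (mem_univ (x + τ • w)) (mem_univ (y + τ • w)) ha hb hab
    have harg : a • (x + τ • w) + b • (y + τ • w) = a • x + b • y + τ • w := by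
      have : τ • w = (a + b) • τ • w := by rw [hab, one_smul]
      conv_rhs => rw [this]
      module
    rw [harg] at h1
    have h2 := convexOn_exp.2 (mem_univ (-A + φ (x + τ • w))) (mem_univ (-B + φ (y + τ • w)))
      ha hb hab
    simp only [smul_eq_mul] at h1 h2 ⊢
    rw [← Real.exp_add, ← Real.exp_add]
    calc Real.exp (φ (a • x + b • y + τ • w)) ≤
          Real.exp ((a * A + b * B) + (a * (-A + φ (x + τ • w)) + b * (-B + φ (y + τ • w)))) :=
          Real.exp_le_exp.2 (by linarith)
      _ = Real.exp (a * A + b * B) * Real.exp (a * (-A + φ (x + τ • w)) +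
          b * (-B + φ (y + τ • w))) := Real.exp_add _ _
      _ ≤ _ := by gcongr
  have hAe : Real.exp (-A) * heatConv φ τ x = 1 := by
    rw [Real.exp_neg, hA, Real.exp_log hx, inv_mul_cancel₀ hx.ne']
  have hBe : Real.exp (-B) * heatConv φ τ y = 1 := by
    rw [Real.exp_neg, hB, Real.exp_log hy, inv_mul_cancel₀ hy.ne']
  have hix := ((hint x).const_mul (Real.exp (-A))).const_mul a
  have hiy := ((hint y).const_mul (Real.exp (-B))).const_mul b
  calc heatConv φ τ (a • x + b • y) ≤ ∫ w, Real.exp (a • A + b • B) *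
      (a * (Real.exp (-A) * Real.exp (φ (x + τ • w))) +
        b * (Real.exp (-B) * Real.exp (φ (y + τ • w)))) ∂gaussian d :=
        integral_mono_of_nonneg (Eventually.of_forall fun w => (Real.exp_pos _).le)
          ((hix.add hiy).const_mul _) (Eventually.of_forall hpt)
    _ = Real.exp (a • A + b • B) * (a * (Real.exp (-A) * heatConv φ τ x) +
          b * (Real.exp (-B) * heatConv φ τ y)) := by
      rw [integral_const_mul, integral_add hix hiy, integral_const_mul, integral_const_mul,
        integral_const_mul, integral_const_mul, heatConv, heatConv]
    _ = Real.exp (a • A + b • B) := by rw [hAe, hBe, mul_one, mul_one, hab, mul_one]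

end HeatConv

/-! ### One-sided Lipschitz bound and behaviour of the field near time zero. -/

section OneSided

variable {d : ℕ} {μ : Measure (E d)} [IsProbabilityMeasure μ] {β : ℝ} {φ : E d → ℝ}

/-- The convex part of the logarithm of the density at time `t`. -/
def convexPart (β : ℝ) (φ : E d → ℝ) (t : ℝ) (x : E d) : ℝ :=
  Real.log (heatConv φ (ouTau β t) ((Real.exp (-t) / ouK β t) • x))

lemma convexOn_convexPart (hβ : 0 < β) (hφ : ConvexOn ℝ univ φ) (h : HasPotential β φ μ) {t : ℝ}
    (ht : 0 < t) : ConvexOn ℝ univ (convexPart β φ t) := by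
  have := (convexOn_log_heatConv hφ fun y => h.integrable_exp hβ ht y).comp_linearMap
    ((Real.exp (-t) / ouK β t) • LinearMap.id)
  exact this

lemma log_tiltMass_eq (hβ : 0 < β) (h : HasPotential β φ μ) {t : ℝ} (ht : 0 < t) (x : E d) :
    convexPart β φ t x = Real.log (tiltMass μ (ouB t • x, ouC t)) -
      Real.log ((gaussConst d)⁻¹ * ouTau β t ^ d) -
        Real.exp (-2 * t) / (2 * ouK β t * ouVar t) * ‖x‖ ^ 2 := by
  have hc := gaussConst_pos d
  have hτ := ouTau_pos hβ ht
  rw [h.tiltMass_eq hβ ht, Real.log_mul (by positivity) (heatConv_pos (h.integrable_exp hβ ht _)).ne',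
    Real.log_mul (by positivity) (by positivity), Real.log_exp, convexPart]
  ring

lemma ouK_eq (β t : ℝ) : ouK β t = 1 + (β - 1) * ouVar t := by
  have : Real.exp (-2 * t) = 1 - ouVar t := by unfold ouVar; ring
  rw [ouK, this]; ring

/-- This exhibits the velocity as a linear field minus the gradient of a convex function, the source
of the contraction estimate. -/
lemma hasFDerivAt_convexPart (hβ : 0 < β) (h : HasPotential β φ μ) {t : ℝ} (ht : 0 < t) (x : E d) :
    HasFDerivAt (convexPart β φ t)
      (innerSL ℝ ((β / ouK β t - 1) • x - flowField μ t x)) x := by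
  have hfun : convexPart β φ t = fun x => Real.log (tiltMass μ (ouB t • x, ouC t)) -
      Real.log ((gaussConst d)⁻¹ * ouTau β t ^ d) -
        Real.exp (-2 * t) / (2 * ouK β t * ouVar t) * ‖x‖ ^ 2 :=
    funext fun x => log_tiltMass_eq hβ h ht x
  rw [hfun]
  set p : E d × ℝ := (ouB t • x, ouC t) with hp
  have hp0 : 0 < p.2 := ouC_pos ht
  have hm0 := tiltMass_pos (μ := μ) hp0
  have hq : HasFDerivAt (fun x : E d => (ouB t • x, ouC t))
      ((ouB t • ContinuousLinearMap.id ℝ (E d)).prod (0 : E d →L[ℝ] ℝ)) x :=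
    ((hasFDerivAt_id x).const_smul (ouB t)).prodMk (hasFDerivAt_const _ x)
  have hlog := ((hasFDerivAt_tiltMass (μ := μ) hp0).comp x hq).log hm0.ne'
  have hmain := (hlog.sub_const (Real.log ((gaussConst d)⁻¹ * ouTau β t ^ d))).sub
    ((hasStrictFDerivAt_norm_sq x).hasFDerivAt.const_mul
      (Real.exp (-2 * t) / (2 * ouK β t * ouVar t)))
  refine hmain.congr_fderiv (ContinuousLinearMap.ext fun w => ?_)
  have hmean : tilt μ (fun z => z) p = tiltMass μ p • tiltMean μ p := by
    rw [tiltMean, smul_inv_smul₀ hm0.ne']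
  have hcomp : ((tilt μ fun _ => (1 : ℝ)) ∘ fun x => (ouB t • x, ouC t)) x = tiltMass μ p := rfl
  have hk := (ouK_pos hβ ht.le).ne'
  have hv := (ouVar_pos ht).ne'
  have hcoef : β / ouK β t - 1 - 2 * ouC t = -(Real.exp (-2 * t) / (ouK β t * ouVar t)) := by
    have : Real.exp (-2 * t) = 1 - ouVar t := by unfold ouVar; ring
    rw [ouC, this]
    field_simp
    rw [ouK_eq]
    ring
  rw [hcomp]
  simp only [_root_.sub_apply, _root_.smul_apply,
    ContinuousLinearMap.comp_apply, ContinuousLinearMap.prod_apply, ← hp,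
    tiltMass_deriv_apply hp0, hmean, flowField,
    inner_sub_left, real_inner_smul_left, ContinuousLinearMap.id_apply,
    innerSL_apply_apply, smul_eq_mul, _root_.zero_apply, real_inner_smul_right]
  have e1 : (tiltMass μ p)⁻¹ * (ouB t * (tiltMass μ p * ⟪tiltMean μ p, w⟫) -
      tilt μ (fun z => ‖z‖ ^ 2) p * 0) = ouB t * ⟪tiltMean μ p, w⟫ := by
    field_simp; ring
  have e2 : Real.exp (-2 * t) / (2 * ouK β t * ouVar t) * 2 =
      Real.exp (-2 * t) / (ouK β t * ouVar t) := by field_simp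
  rw [e1, two_nsmul]
  linear_combination -⟪x, w⟫ * hcoef - ⟪x, w⟫ * e2

/-- Monotonicity of the gradient of `convexPart`, obtained by adding the gradient inequalities at
`x` and `y`. -/
lemma inner_flowField_sub_le (hβ : 0 < β) (hφ : ConvexOn ℝ univ φ) (h : HasPotential β φ μ) {t : ℝ}
    (ht : 0 < t) (x y : E d) :
    ⟪flowField μ t x - flowField μ t y, x - y⟫ ≤ (β / ouK β t - 1) * ‖x - y‖ ^ 2 := by
  have hc := convexOn_convexPart hβ hφ h ht
  have h1 := convexOn_gradient_inequality hc (hasFDerivAt_convexPart hβ h ht x) (y - x)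
  have h2 := convexOn_gradient_inequality hc (hasFDerivAt_convexPart hβ h ht y) (x - y)
  rw [add_sub_cancel, innerSL_apply_apply] at h1 h2
  rw [← neg_sub x y, inner_neg_right] at h1
  have h3 : ⟪(β / ouK β t - 1) • x - flowField μ t x, x - y⟫ -
      ⟪(β / ouK β t - 1) • y - flowField μ t y, x - y⟫ =
      (β / ouK β t - 1) * ‖x - y‖ ^ 2 - ⟪flowField μ t x - flowField μ t y, x - y⟫ := by
    rw [← inner_sub_left, ← real_inner_self_eq_norm_sq, ← real_inner_smul_left, ← inner_sub_left]
    congr 1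
    module
  linarith

lemma min_one_le_ouK (β : ℝ) {t : ℝ} (ht : 0 ≤ t) : min 1 β ≤ ouK β t := by
  have hv : 0 ≤ ouVar t := by
    unfold ouVar; rw [sub_nonneg, Real.exp_le_one_iff]; linarith
  have hv1 := ouVar_lt_one t
  rw [ouK_eq]
  nlinarith [min_le_left 1 β, min_le_right 1 β]

lemma ouVar_mono : Monotone ouVar := fun s t hst => by
  unfold ouVar
  have : Real.exp (-2 * t) ≤ Real.exp (-2 * s) := Real.exp_le_exp.2 (by linarith)
  linarith

lemma ouTau_mono (hβ : 0 < β) {s t : ℝ} (hs : 0 < s) (hst : s ≤ t) : ouTau β s ≤ ouTau β t := by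
  refine Real.sqrt_le_sqrt ?_
  rw [div_le_div_iff₀ (ouK_pos hβ hs.le) (ouK_pos hβ (hs.le.trans hst)), ouK_eq, ouK_eq]
  have := ouVar_mono hst
  nlinarith

/-- The velocity field stays bounded at each point as `t → 0`. -/
lemma exists_bound_flowField_zero (hβ : 0 < β) (hφ : ConvexOn ℝ univ φ) (h : HasPotential β φ μ)
    (x : E d) : ∃ C : ℝ, ∀ t ∈ Ioc (0 : ℝ) 1, ‖flowField μ t x‖ ≤ C := by
  set m := min 1 β with hm
  have hm0 : 0 < m := lt_min one_pos hβ
  have hφc : Continuous φ := h.1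
  -- By `heatConv_mono`, the convolution at time `1` is an upper envelope for all `t ≤ 1`, while
  -- `exp φ` is a lower one. Both logarithms are continuous, hence bounded on compact sets uniformly
  -- in `t`.
  have hHc : Continuous (fun y => Real.log (heatConv φ (ouTau β 1) y)) := by
    have := (convexOn_log_heatConv hφ fun y => h.integrable_exp hβ one_pos y).continuousOn isOpen_univ
    exact continuousOn_univ.1 this
  obtain ⟨C₁, hC₁⟩ := (isCompact_closedBall (0 : E d) ((‖x‖ + 1) / m)).exists_bound_of_continuousOn
    hHc.continuousOn
  obtain ⟨C₂, hC₂⟩ := (isCompact_closedBall (0 : E d) ((‖x‖ + 1) / m)).exists_bound_of_continuousOn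
    hφc.continuousOn
  refine ⟨(β / m + 1) * ‖x‖ + max (C₁ + C₂) 0, fun t ht => ?_⟩
  have hk := ouK_pos hβ ht.1.le
  have hmk := min_one_le_ouK β ht.1.le
  have hball : ∀ y : E d, ‖y‖ ≤ ‖x‖ + 1 →
      (Real.exp (-t) / ouK β t) • y ∈ closedBall (0 : E d) ((‖x‖ + 1) / m) := by
    intro y hy
    rw [mem_closedBall_zero_iff, norm_smul, Real.norm_of_nonneg (by positivity)]
    calc Real.exp (-t) / ouK β t * ‖y‖ ≤ 1 / m * (‖x‖ + 1) := by
          gcongr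
          exact Real.exp_le_one_iff.2 (by linarith [ht.1])
      _ = _ := by ring
  set w := (β / ouK β t - 1) • x - flowField μ t x with hw
  have hwb : ‖w‖ ≤ max (C₁ + C₂) 0 := by
    rcases eq_or_ne w 0 with h0 | h0
    · rw [h0, norm_zero]; exact le_max_right _ _
    have hn : ‖w‖ ≠ 0 := norm_ne_zero_iff.2 h0
    -- A unit step along the gradient `w` bounds `‖w‖` by a difference of two values of the convex
    -- function.
    have h1 := convexOn_gradient_inequality (convexOn_convexPart hβ hφ h ht.1)
      (hasFDerivAt_convexPart hβ h ht.1 x) (‖w‖⁻¹ • w)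
    rw [← hw, innerSL_apply_apply, real_inner_smul_right, real_inner_self_eq_norm_sq, sq,
      inv_mul_cancel_left₀ hn] at h1
    have hu : ‖‖w‖⁻¹ • w‖ = 1 := by rw [norm_smul, norm_inv, norm_norm, inv_mul_cancel₀ hn]
    have h2 : convexPart β φ t (x + ‖w‖⁻¹ • w) ≤ C₁ := by
      have hb := hball (x + ‖w‖⁻¹ • w) ((norm_add_le _ _).trans (by rw [hu]))
      refine (Real.log_le_log (heatConv_pos (h.integrable_exp hβ ht.1 _))
        (heatConv_mono hφ (ouTau_pos hβ ht.1).le (ouTau_mono hβ ht.1 ht.2)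
          (h.integrable_exp hβ one_pos _))).trans ?_
      exact (le_abs_self _).trans (hC₁ _ hb)
    have h3 : -C₂ ≤ convexPart β φ t x := by
      have hb := hball x (by linarith)
      have h4 := Real.log_le_log (Real.exp_pos _) (heatConv_zero (φ := φ)
        ((Real.exp (-t) / ouK β t) • x) ▸ heatConv_mono hφ le_rfl (ouTau_pos hβ ht.1).le
          (h.integrable_exp hβ ht.1 ((Real.exp (-t) / ouK β t) • x)))
      rw [Real.log_exp] at h4
      exact (abs_le.1 (hC₂ _ hb)).1.trans h4
    exact (h1.trans (by linarith)).trans (le_max_left _ _)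
  have hV : flowField μ t x = (β / ouK β t - 1) • x - w := by rw [hw]; abel
  rw [hV]
  refine (norm_sub_le _ _).trans (add_le_add ?_ hwb)
  rw [norm_smul, Real.norm_eq_abs]
  gcongr
  rw [abs_le]
  have h5 : β / ouK β t ≤ β / m := by gcongr
  have h6 : 0 < β / ouK β t := by positivity
  constructor <;> linarith

end OneSided

/-! ### Integrable decay of the field at infinity. -/

section Decay

variable {V : Type*} [NormedAddCommGroup V] [InnerProductSpace ℝ V] [FiniteDimensional ℝ V]
  [MeasurableSpace V] [BorelSpace V] {μ : Measure V}

/-- A bounded primitive of `decayRate`. -/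
def decayPrimitive (μ : Measure V) (t : ℝ) : ℝ :=
  -(Real.exp (-t) + ∫ z, Real.arctan (Real.exp (-t) * ‖z‖) ∂μ)

/-- The rate at which the velocity field decays on bounded sets as `t → ∞`. It is integrable in time
without any moment assumption on `μ`. -/
def decayRate (μ : Measure V) (t : ℝ) : ℝ :=
  Real.exp (-t) + ∫ z, Real.exp (-t) * ‖z‖ / (1 + (Real.exp (-t) * ‖z‖) ^ 2) ∂μ

lemma div_one_add_sq_mem_Icc {u : ℝ} (hu : 0 ≤ u) : u / (1 + u ^ 2) ∈ Icc (0 : ℝ) 1 := by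
  refine ⟨by positivity, (div_le_one (by positivity)).2 ?_⟩
  nlinarith [sq_nonneg (u - 1)]

lemma integrable_decayRate [IsFiniteMeasure μ] (t : ℝ) :
    Integrable (fun z : V => Real.exp (-t) * ‖z‖ / (1 + (Real.exp (-t) * ‖z‖) ^ 2)) μ := by
  refine Integrable.of_bound (C := 1) ?_ (Eventually.of_forall fun z => ?_)
  · refine (Continuous.div (by fun_prop) (by fun_prop) fun z => ?_).aestronglyMeasurable
    positivity
  · have := div_one_add_sq_mem_Icc (u := Real.exp (-t) * ‖z‖) (by positivity)
    rw [Real.norm_of_nonneg this.1]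
    exact this.2

lemma decayRate_nonneg (t : ℝ) : 0 ≤ decayRate μ t :=
  add_nonneg (Real.exp_pos _).le (integral_nonneg fun z =>
    (div_one_add_sq_mem_Icc (u := Real.exp (-t) * ‖z‖) (by positivity)).1)

/-- With `u = e^{-t} ‖z‖`, the time derivative of `arctan u` is `-u / (1 + u²)`, bounded by `1`, so
differentiation under the integral needs no moment of `μ`. -/
lemma hasDerivAt_decayPrimitive [IsFiniteMeasure μ] (t : ℝ) :
    HasDerivAt (decayPrimitive μ) (decayRate μ t) t := by
  have hexp : ∀ s : ℝ, HasDerivAt (fun s => Real.exp (-s)) (-Real.exp (-s)) s := fun s => by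
    simpa using (hasDerivAt_neg s).exp
  have hmain := (hasDerivAt_integral_of_dominated_loc_of_deriv_le (μ := μ) (x₀ := t) (s := univ)
    (F := fun s z => Real.arctan (Real.exp (-s) * ‖z‖))
    (F' := fun s z => -(Real.exp (-s) * ‖z‖ / (1 + (Real.exp (-s) * ‖z‖) ^ 2)))
    (bound := fun _ => 1) univ_mem
    (Eventually.of_forall fun s => (Continuous.aestronglyMeasurable (by fun_prop)))
    (Integrable.of_bound (C := Real.pi / 2) (Continuous.aestronglyMeasurable (by fun_prop))
      (Eventually.of_forall fun z => abs_le.2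
        ⟨(Real.neg_pi_div_two_lt_arctan _).le, (Real.arctan_lt_pi_div_two _).le⟩))
    (integrable_decayRate t).neg.aestronglyMeasurable
    (Eventually.of_forall fun z s _ => ?_) (integrable_const _)
    (Eventually.of_forall fun z s _ => ?_)).2
  · have := ((hexp t).add hmain).neg
    refine this.congr_deriv ?_
    rw [integral_neg, decayRate]
    ring
  · have := div_one_add_sq_mem_Icc (u := Real.exp (-s) * ‖z‖) (by positivity)
    rw [norm_neg, Real.norm_of_nonneg this.1]
    exact this.2
  · refine ((hexp s).mul_const ‖z‖).arctan.congr_deriv ?_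
    ring

lemma monotone_decayPrimitive [IsFiniteMeasure μ] : Monotone (decayPrimitive μ) :=
  monotone_of_hasDerivAt_nonneg hasDerivAt_decayPrimitive fun t => decayRate_nonneg t

lemma decayPrimitive_nonpos (t : ℝ) : decayPrimitive μ t ≤ 0 :=
  neg_nonpos.2 (add_nonneg (Real.exp_pos _).le (integral_nonneg fun z =>
    Real.arctan_nonneg.2 (by positivity)))

lemma exists_tendsto_decayPrimitive [IsFiniteMeasure μ] :
    ∃ l, Tendsto (decayPrimitive μ) atTop (𝓝 l) :=
  ⟨_, tendsto_atTop_ciSup monotone_decayPrimitive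
    ⟨0, by rintro _ ⟨t, rfl⟩; exact decayPrimitive_nonpos t⟩⟩

/-- For `t ≥ 1`, with `u = e^{-t} ‖z‖`, the tilt weight is at most `exp (2 R u - u² / 2)`. Hence `u`
times this weight is at most a constant times `u / (1 + u²)`, the integrand of `decayRate`. -/
lemma exists_bound_flowField_atTop [IsFiniteMeasure μ] [NeZero μ] (R : ℝ) :
    ∃ C : ℝ, 0 ≤ C ∧ ∀ t, 1 ≤ t → ∀ x, ‖x‖ ≤ R → ‖flowField μ t x‖ ≤ C * decayRate μ t := by
  rcases lt_or_ge R 0 with hR | hR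
  · exact ⟨0, le_rfl, fun t _ x hx => absurd (norm_nonneg x) (by linarith)⟩
  obtain ⟨C, hC0, hC⟩ := exists_pow_mul_exp_le 2 (2 * R) (η := 1 / 2) (by norm_num)
  -- A minorant of the tilt weight for all `t ≥ 1` and `‖x‖ ≤ R`, keeping the mass in the
  -- denominator away from zero.
  set g : V → ℝ := fun z => Real.exp (-(2 * R * ‖z‖) - ‖z‖ ^ 2) with hg
  have hgi : Integrable g μ := by
    refine Integrable.of_bound (C := 1) (Continuous.aestronglyMeasurable (by fun_prop))
      (Eventually.of_forall fun z => ?_)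
    rw [hg, Real.norm_of_nonneg (Real.exp_pos _).le, Real.exp_le_one_iff]
    have : 0 ≤ 2 * R * ‖z‖ := by positivity
    nlinarith [sq_nonneg ‖z‖]
  have hm : 0 < ∫ z, g z ∂μ := by
    rw [integral_pos_iff_support_of_nonneg (fun w => (Real.exp_pos _).le) hgi]
    have : Function.support g = univ := by
      ext w; simp [hg, (Real.exp_pos _).ne']
    rw [this]
    exact Measure.measure_univ_pos.2 (NeZero.ne μ)
  set m := ∫ z, g z ∂μ with hmdef
  refine ⟨2 * R + 2 * C / m, by positivity, fun t ht x hx => ?_⟩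
  have ht0 : 0 < t := by linarith
  set a := Real.exp (-t) with ha
  have ha0 : 0 < a := Real.exp_pos _
  have ha1 : a ≤ 1 := Real.exp_le_one_iff.2 (by linarith)
  have haa : Real.exp (-2 * t) = a ^ 2 := exp_neg_two_mul t
  have hv : ouVar t = 1 - a ^ 2 := by rw [ouVar, haa]
  have ha2 : a ^ 2 ≤ 1 / 2 := by
    rw [← haa, neg_mul, Real.exp_neg, ← one_div]
    exact one_div_le_one_div_of_le two_pos (by linarith [Real.add_one_le_exp (2 * t)])
  have hv0 := ouVar_pos ht0
  have hb : ouB t ≤ 2 * a := by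
    rw [ouB, div_le_iff₀ hv0, hv]; nlinarith
  have hb0 := ouB_pos ht0
  have hc : ouC t ≤ a ^ 2 := by
    rw [ouC, haa, div_le_iff₀ (by positivity), hv]; nlinarith [sq_nonneg a]
  have hc' : a ^ 2 / 2 ≤ ouC t := by
    rw [ouC, haa, div_le_div_iff₀ two_pos (by positivity), hv]; nlinarith [sq_nonneg (a ^ 2)]
  have hc0 := ouC_pos ht0
  set p : V × ℝ := (ouB t • x, ouC t) with hp
  have hp0 : 0 < p.2 := hc0
  have hform : ∀ z : V, |⟪z, p.1⟫| ≤ 2 * R * (a * ‖z‖) := fun z => by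
    rw [hp, real_inner_smul_right, abs_mul, abs_of_pos hb0]
    calc ouB t * |⟪z, x⟫| ≤ (2 * a) * (‖z‖ * R) := by
          gcongr
          exact (abs_real_inner_le_norm z x).trans (by gcongr)
      _ = _ := by ring
  have hmass : m ≤ tiltMass μ p := by
    have hi := (PolyGrowth.const (V := V) (1 : ℝ)).integrable (μ := μ) hp0
    refine integral_mono hgi hi fun z => ?_
    simp only [hg, smul_eq_mul, mul_one]
    rw [Real.exp_le_exp, tiltForm_apply]
    have h1 := (abs_le.1 (hform z)).1
    have h2 : 2 * R * (a * ‖z‖) ≤ 2 * R * (1 * ‖z‖) := by gcongr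
    have h3 : ‖z‖ ^ 2 * p.2 ≤ ‖z‖ ^ 2 * 1 := by gcongr; exact hc.trans (by linarith)
    linarith
  have hnum : a * ‖tilt μ (fun z => z) p‖ ≤
      C * ∫ z, a * ‖z‖ / (1 + (a * ‖z‖) ^ 2) ∂μ := by
    rw [← integral_const_mul]
    calc a * ‖tilt μ (fun z => z) p‖
        ≤ a * ∫ z, ‖Real.exp (tiltForm z p) • z‖ ∂μ := by
          gcongr; exact norm_integral_le_integral_norm _
      _ = ∫ z, a * ‖Real.exp (tiltForm z p) • z‖ ∂μ := (integral_const_mul _ _).symm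
      _ ≤ _ := by
        refine integral_mono_of_nonneg (Eventually.of_forall fun z => by positivity)
          ((integrable_decayRate t).const_mul C) (Eventually.of_forall fun z => ?_)
        simp only
        rw [norm_smul, Real.norm_of_nonneg (Real.exp_pos _).le]
        set u := a * ‖z‖ with hu
        have hu0 : 0 ≤ u := by positivity
        have h1 : Real.exp (tiltForm z p) ≤ Real.exp (2 * R * u - 1 / 2 * u ^ 2) := by
          rw [Real.exp_le_exp, tiltForm_apply]
          have h2 := (abs_le.1 (hform z)).2
          have h3 : ‖z‖ ^ 2 * (a ^ 2 / 2) ≤ ‖z‖ ^ 2 * p.2 := by gcongr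
          have h4 : 1 / 2 * u ^ 2 = ‖z‖ ^ 2 * (a ^ 2 / 2) := by rw [hu]; ring
          linarith
        have h5 := hC u hu0
        have h6 : (1 + u ^ 2) * Real.exp (tiltForm z p) ≤ C := by
          refine le_trans ?_ h5
          gcongr
          nlinarith
        calc a * (Real.exp (tiltForm z p) * ‖z‖) = Real.exp (tiltForm z p) * u := by rw [hu]; ring
          _ = (1 + u ^ 2) * Real.exp (tiltForm z p) * (u / (1 + u ^ 2)) := by field_simp
          _ ≤ C * (u / (1 + u ^ 2)) := by gcongr
  have hI : 0 ≤ ∫ z, a * ‖z‖ / (1 + (a * ‖z‖) ^ 2) ∂μ := integral_nonneg fun z =>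
    (div_one_add_sq_mem_Icc (u := a * ‖z‖) (by positivity)).1
  have hmp := tiltMass_pos (μ := μ) hp0
  calc ‖flowField μ t x‖ ≤ 2 * ouC t * ‖x‖ + ouB t * ((tiltMass μ p)⁻¹ * ‖tilt μ (fun z => z) p‖) := by
        rw [flowField, tiltMean]
        refine (norm_sub_le _ _).trans (le_of_eq ?_)
        rw [norm_smul, norm_smul, norm_smul, norm_inv, Real.norm_of_nonneg hmp.le,
          Real.norm_of_nonneg hb0.le, Real.norm_of_nonneg (by positivity : 0 ≤ 2 * ouC t)]
    _ ≤ 2 * a * R + 2 * a * (m⁻¹ * ‖tilt μ (fun z => z) p‖) := by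
        gcongr
        nlinarith
    _ = 2 * R * a + 2 / m * (a * ‖tilt μ (fun z => z) p‖) := by ring
    _ ≤ 2 * R * a + 2 / m * (C * ∫ z, a * ‖z‖ / (1 + (a * ‖z‖) ^ 2) ∂μ) := by gcongr
    _ ≤ (2 * R + 2 * C / m) * (a + ∫ z, a * ‖z‖ / (1 + (a * ‖z‖) ^ 2) ∂μ) := by
        have : 0 ≤ 2 * C / m * a := by positivity
        have h2 : 0 ≤ 2 * R * ∫ z, a * ‖z‖ / (1 + (a * ‖z‖) ^ 2) ∂μ := by positivity
        have h3 : 2 / m * (C * ∫ z, a * ‖z‖ / (1 + (a * ‖z‖) ^ 2) ∂μ) =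
          2 * C / m * ∫ z, a * ‖z‖ / (1 + (a * ‖z‖) ^ 2) ∂μ := by ring
        rw [h3]
        linarith

end Decay

/-! ### Contraction estimates along trajectories. -/

section Contraction

variable {d : ℕ} {μ : Measure (E d)} [IsProbabilityMeasure μ] {β : ℝ} {φ : E d → ℝ}

lemma hasDerivAt_ouK (β t : ℝ) : HasDerivAt (ouK β) (2 * (β - 1) * Real.exp (-2 * t)) t := by
  have : ouK β = fun t => 1 + (β - 1) * ouVar t := funext (ouK_eq β)
  rw [this]
  exact (((hasDerivAt_ouVar t).const_mul (β - 1)).const_add 1).congr_deriv (by ring)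

/-- Derivative bound for the weighted squared distance of two curves. -/
lemma weighted_sq_dist_hasDerivWithinAt (hβ : 0 < β) {X : ℝ → E d} {X' : E d}
    {s : Set ℝ} {t : ℝ} (ht : 0 < t) (hX : HasDerivWithinAt X X' s t) :
    HasDerivWithinAt (fun τ => ‖X τ‖ ^ 2 / ouK β τ)
      (2 / ouK β t * (⟪X', X t⟫ - (β / ouK β t - 1) * ‖X t‖ ^ 2)) s t := by
  have hk := ouK_pos hβ ht.le
  refine (hX.norm_sq.div (hasDerivAt_ouK β t).hasDerivWithinAt hk.ne').congr_deriv ?_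
  rw [real_inner_comm]
  have h1 : (β - 1) * Real.exp (-2 * t) = β - ouK β t := by
    rw [ouK_eq]; unfold ouVar; ring
  have h2 : 2 * (β - 1) * Real.exp (-2 * t) = 2 * (β - ouK β t) := by rw [← h1]; ring
  rw [h2]
  field_simp

variable (hβ : 0 < β) (hφ : ConvexOn ℝ univ φ) (h : HasPotential β φ μ)

include hβ hφ h

/-- The weight is chosen so that `k' / k = 2 (β / k - 1)` exactly compensates the one-sided
Lipschitz constant; keeping it sharp is what yields the final `√β`. -/
lemma antitoneOn_weighted_sq_dist {I : Set ℝ} (hI : Convex ℝ I) (hI0 : I ⊆ Ioi 0) {X Y : ℝ → E d}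
    (hX : IsIntegralCurveOn X (flowField μ) I) (hY : IsIntegralCurveOn Y (flowField μ) I) :
    AntitoneOn (fun t => ‖X t - Y t‖ ^ 2 / ouK β t) I := by
  have hd : ∀ t ∈ I, HasDerivWithinAt (fun τ => ‖X τ - Y τ‖ ^ 2 / ouK β τ) _ I t := fun t ht =>
    weighted_sq_dist_hasDerivWithinAt hβ (hI0 ht) ((hX t ht).sub (hY t ht))
  refine antitoneOn_of_hasDerivWithinAt_nonpos hI (fun t ht => (hd t ht).continuousWithinAt)
    (fun t ht => (hd t (interior_subset ht)).mono interior_subset) fun t ht => ?_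
  have ht0 : 0 < t := hI0 (interior_subset ht)
  have hk := ouK_pos hβ ht0.le
  have := inner_flowField_sub_le hβ hφ h ht0 (X t) (Y t)
  exact mul_nonpos_of_nonneg_of_nonpos (by positivity) (by simpa using this)

lemma norm_sub_le_of_integralCurve {I : Set ℝ} (hI : Convex ℝ I) (hI0 : I ⊆ Ioi 0) {X Y : ℝ → E d}
    (hX : IsIntegralCurveOn X (flowField μ) I) (hY : IsIntegralCurveOn Y (flowField μ) I)
    {s t : ℝ} (hs : s ∈ I) (ht : t ∈ I) (hst : s ≤ t) :
    ‖X t - Y t‖ ≤ Real.sqrt (ouK β t / ouK β s) * ‖X s - Y s‖ := by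
  have h1 := antitoneOn_weighted_sq_dist hβ hφ h hI hI0 hX hY hs ht hst
  have hks := ouK_pos hβ (hI0 hs : (0 : ℝ) < s).le
  have hkt := ouK_pos hβ (hI0 ht : (0 : ℝ) < t).le
  simp only at h1
  rw [div_le_div_iff₀ hkt hks] at h1
  refine le_of_sq_le_sq ?_ (by positivity)
  rw [mul_pow, Real.sq_sqrt (by positivity), div_mul_eq_mul_div, le_div_iff₀ hks]
  linarith

/-- Growth of the distance of a trajectory from a fixed point. -/
lemma weighted_sq_dist_le_exp {I : Set ℝ} (hI : Convex ℝ I) (hI0 : I ⊆ Ioi 0) {X : ℝ → E d}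
    (hX : IsIntegralCurveOn X (flowField μ) I) (y : E d) {B b : ℝ → ℝ}
    (hB : ∀ t ∈ I, HasDerivWithinAt B (b t) I t) (hb : ∀ t ∈ I, ‖flowField μ t y‖ ≤ b t)
    {s t : ℝ} (hs : s ∈ I) (ht : t ∈ I) (hst : s ≤ t) :
    1 / min 1 β + ‖X t - y‖ ^ 2 / ouK β t ≤
      Real.exp (B t - B s) * (1 / min 1 β + ‖X s - y‖ ^ 2 / ouK β s) := by
  set κ := 1 / min 1 β with hκ
  have hm : 0 < min 1 β := lt_min one_pos hβ
  have hd : ∀ t ∈ I, HasDerivWithinAt (fun τ => ‖X τ - y‖ ^ 2 / ouK β τ) _ I t := fun t ht =>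
    weighted_sq_dist_hasDerivWithinAt hβ (hI0 ht) ((hX t ht).sub_const y)
  have hd' : ∀ t ∈ I, HasDerivWithinAt
      (fun τ => Real.exp (-B τ) * (κ + ‖X τ - y‖ ^ 2 / ouK β τ)) _ I t := fun t ht =>
    (hB t ht).neg.exp.mul ((hd t ht).const_add κ)
  have hanti : AntitoneOn (fun τ => Real.exp (-B τ) * (κ + ‖X τ - y‖ ^ 2 / ouK β τ)) I := by
    refine antitoneOn_of_hasDerivWithinAt_nonpos hI (fun t ht => (hd' t ht).continuousWithinAt)
      (fun t ht => (hd' t (interior_subset ht)).mono interior_subset) fun t ht => ?_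
    have htI := interior_subset ht
    have ht0 : 0 < t := hI0 htI
    have hk := ouK_pos hβ ht0.le
    have hmk := min_one_le_ouK β ht0.le
    have h1 := inner_flowField_sub_le hβ hφ h ht0 (X t) y
    rw [inner_sub_left] at h1
    have h2 : ⟪flowField μ t y, X t - y⟫ ≤ b t * ‖X t - y‖ :=
      (real_inner_le_norm _ _).trans (by gcongr; exact hb t htI)
    have hb0 : 0 ≤ b t := (norm_nonneg _).trans (hb t htI)
    -- From `2 r ≤ 1 + r²`. The constant `κ = 1 / min 1 β` dominates `1 / ouK β t` at all times,
    -- which closes a linear differential inequality.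
    have h3 : 2 / ouK β t * ‖X t - y‖ ≤ κ + ‖X t - y‖ ^ 2 / ouK β t := by
      have h4 : 1 / ouK β t ≤ κ := by rw [hκ]; gcongr
      have h5 : 2 / ouK β t * ‖X t - y‖ ≤ 1 / ouK β t + ‖X t - y‖ ^ 2 / ouK β t := by
        rw [div_mul_eq_mul_div, ← add_div]
        gcongr
        nlinarith [sq_nonneg (‖X t - y‖ - 1)]
      linarith
    have h6 : 2 / ouK β t * (⟪flowField μ t (X t), X t - y⟫ -
        (β / ouK β t - 1) * ‖X t - y‖ ^ 2) ≤ b t * (κ + ‖X t - y‖ ^ 2 / ouK β t) := by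
      calc _ ≤ 2 / ouK β t * (b t * ‖X t - y‖) := by gcongr; linarith
        _ = b t * (2 / ouK β t * ‖X t - y‖) := by ring
        _ ≤ _ := by gcongr
    have hE := Real.exp_pos (-B t)
    simp only [Pi.neg_apply]
    nlinarith
  have h1 := hanti hs ht hst
  simp only at h1
  have hE := Real.exp_pos (B t)
  have h2 : Real.exp (B t) * (Real.exp (-B t) * (κ + ‖X t - y‖ ^ 2 / ouK β t)) ≤
      Real.exp (B t) * (Real.exp (-B s) * (κ + ‖X s - y‖ ^ 2 / ouK β s)) := by gcongr
  rwa [← mul_assoc, ← mul_assoc, ← Real.exp_add, ← Real.exp_add, add_neg_cancel, Real.exp_zero,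
    one_mul, ← sub_eq_add_neg] at h2

lemma exists_isIntegralCurveOn_flowField {a b : ℝ} (ha : 0 < a) (hab : a ≤ b) (x : E d) :
    ∃ γ, γ a = x ∧ IsIntegralCurveOn γ (flowField μ) (Icc a b) := by
  have hsub : Icc a b ⊆ Ioi 0 := fun t ht => ha.trans_le ht.1
  obtain ⟨C, hC⟩ := isCompact_Icc.exists_bound_of_continuousOn
    ((continuousOn_flowField (μ := μ) (0 : E d)).mono hsub)
  have hm : 0 < min 1 β := lt_min one_pos hβ
  have hC0 : 0 ≤ C := (norm_nonneg _).trans (hC a ⟨le_rfl, hab⟩)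
  refine exists_isIntegralCurveOn_of_growth hab (C := β / min 1 β + C) (by positivity)
    (fun t ht x => ?_) (fun R => lipschitzOnWith_flowField ha R)
    (fun x => (continuousOn_flowField x).mono hsub) x
  have ht0 : 0 < t := hsub ht
  have h1 := inner_flowField_sub_le hβ hφ h ht0 x 0
  rw [inner_sub_left, sub_zero] at h1
  have h2 : ⟪flowField μ t 0, x⟫ ≤ C * ‖x‖ :=
    (real_inner_le_norm _ _).trans (by gcongr; exact hC t ht)
  have hmk := min_one_le_ouK β ht0.le
  have h3 : β / ouK β t ≤ β / min 1 β := by gcongr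
  have h4 : ‖x‖ ≤ 1 + ‖x‖ ^ 2 := by nlinarith [sq_nonneg (‖x‖ - 1)]
  have h5 : (β / ouK β t - 1) * ‖x‖ ^ 2 ≤ β / min 1 β * (1 + ‖x‖ ^ 2) := by
    have : 0 < β / min 1 β := by positivity
    nlinarith [sq_nonneg ‖x‖]
  nlinarith

end Contraction

/-! ### Construction of the flow from time zero and its limit at infinity. -/

section FlowConstruction

variable {d : ℕ} {μ : Measure (E d)} [IsProbabilityMeasure μ] {β : ℝ} {φ : E d → ℝ}

lemma continuous_ouK (β : ℝ) : Continuous (ouK β) :=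
  continuous_iff_continuousAt.2 fun t => (hasDerivAt_ouK β t).continuousAt

lemma ouK_zero (β : ℝ) : ouK β 0 = 1 := by simp [ouK, ouVar]

lemma ouK_le_max (β : ℝ) {t : ℝ} (ht : 0 ≤ t) : ouK β t ≤ max 1 β := by
  have hv : 0 ≤ ouVar t := by
    unfold ouVar; rw [sub_nonneg, Real.exp_le_one_iff]; linarith
  have hv1 := ouVar_lt_one t
  rw [ouK_eq]
  nlinarith [le_max_left 1 β, le_max_right 1 β]

lemma tendsto_ouK_atTop (β : ℝ) : Tendsto (ouK β) atTop (𝓝 β) := by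
  have h1 : Tendsto (fun t : ℝ => Real.exp (-2 * t)) atTop (𝓝 0) :=
    Real.tendsto_exp_atBot.comp (tendsto_id.const_mul_atTop_of_neg (by norm_num))
  have h2 : ouK β = fun t => 1 + (β - 1) * (1 - Real.exp (-2 * t)) := funext (ouK_eq β)
  rw [h2]
  simpa using ((h1.const_sub 1).const_mul (β - 1)).const_add 1

variable (hβ : 0 < β) (hφ : ConvexOn ℝ univ φ) (h : HasPotential β φ μ)

include hβ hφ h

lemma exists_isIntegralCurveOn_Ici {a : ℝ} (ha : 0 < a) (x : E d) :
    ∃ γ, γ a = x ∧ IsIntegralCurveOn γ (flowField μ) (Ici a) := by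
  have hex : ∀ b : ℝ, ∃ γ : ℝ → E d, a ≤ b →
      γ a = x ∧ IsIntegralCurveOn γ (flowField μ) (Icc a b) := fun b => by
    by_cases hab : a ≤ b
    · obtain ⟨γ, h1, h2⟩ := exists_isIntegralCurveOn_flowField hβ hφ h ha hab x
      exact ⟨γ, fun _ => ⟨h1, h2⟩⟩
    · exact ⟨fun _ => x, fun h => absurd h hab⟩
  choose γ hγ using hex
  have heq : ∀ b c, a ≤ b → b ≤ c → EqOn (γ b) (γ c) (Icc a b) := by
    intro b c hab hbc t ht
    have hI0 : Icc a b ⊆ Ioi 0 := fun t ht => ha.trans_le ht.1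
    have h1 := (hγ b hab).2
    have h2 : IsIntegralCurveOn (γ c) (flowField μ) (Icc a b) :=
      (hγ c (hab.trans hbc)).2.mono (Icc_subset_Icc_right hbc)
    have := norm_sub_le_of_integralCurve hβ hφ h (convex_Icc a b) hI0 h1 h2 ⟨le_rfl, hab⟩ ht ht.1
    rw [(hγ b hab).1, (hγ c (hab.trans hbc)).1, sub_self, norm_zero, mul_zero] at this
    exact sub_eq_zero.1 (norm_le_zero_iff.1 this)
  -- The solutions on `[a, b]` agree on overlaps, so the diagonal glues them; near `t` it equals the
  -- solution on `[a, t + 1]`.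
  refine ⟨fun t => γ t t, (hγ a le_rfl).1, fun t ht => ?_⟩
  have hat : a ≤ t := ht
  have hat1 : a ≤ t + 1 := by linarith
  have h1 : HasDerivWithinAt (γ (t + 1)) (flowField μ t (γ (t + 1) t)) (Icc a (t + 1)) t :=
    (hγ (t + 1) hat1).2 t ⟨hat, by linarith⟩
  have h2 : HasDerivWithinAt (γ (t + 1)) (flowField μ t (γ (t + 1) t)) (Ici a) t := by
    refine h1.mono_of_mem_nhdsWithin ?_
    filter_upwards [self_mem_nhdsWithin, mem_nhdsWithin_of_mem_nhds (Iic_mem_nhds (lt_add_one t))]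
      with s hs1 hs2 using ⟨hs1, hs2⟩
  have h3 : γ t t = γ (t + 1) t := heq t (t + 1) hat (by linarith) ⟨hat, le_rfl⟩
  simp only [h3]
  refine h2.congr_of_eventuallyEq_of_mem ?_ ht
  filter_upwards [self_mem_nhdsWithin, mem_nhdsWithin_of_mem_nhds (Iic_mem_nhds (lt_add_one t))]
    with s hs1 hs2
  exact heq s (t + 1) hs1 hs2 ⟨hs1, le_rfl⟩

/-- Two solutions that extend continuously to `t = 0` separate at most by the factor `√(ouK β t)`. -/
lemma norm_sub_le_of_flow {X Y : ℝ → E d} (hX : IsIntegralCurveOn X (flowField μ) (Ioi 0))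
    (hX0 : ContinuousWithinAt X (Ici 0) 0) (hY : IsIntegralCurveOn Y (flowField μ) (Ioi 0))
    (hY0 : ContinuousWithinAt Y (Ici 0) 0) {t : ℝ} (ht : 0 ≤ t) :
    ‖X t - Y t‖ ≤ Real.sqrt (ouK β t) * ‖X 0 - Y 0‖ := by
  rcases ht.eq_or_lt with rfl | ht0
  · simp [ouK_zero]
  have hlim : Tendsto (fun s => Real.sqrt (ouK β t / ouK β s) * ‖X s - Y s‖) (𝓝[>] 0)
      (𝓝 (Real.sqrt (ouK β t / ouK β 0) * ‖X 0 - Y 0‖)) := by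
    refine Tendsto.mul ?_ (((hX0.mono Ioi_subset_Ici_self).sub
      (hY0.mono Ioi_subset_Ici_self)).norm)
    refine (Real.continuous_sqrt.tendsto _).comp (tendsto_const_nhds.div
      (((continuous_ouK β).tendsto 0).mono_left nhdsWithin_le_nhds) ?_)
    rw [ouK_zero]; exact one_ne_zero
  rw [ouK_zero, div_one] at hlim
  refine ge_of_tendsto hlim ?_
  filter_upwards [self_mem_nhdsWithin, mem_nhdsWithin_of_mem_nhds (Iio_mem_nhds ht0)] with s hs hst
  exact norm_sub_le_of_integralCurve hβ hφ h (convex_Ioi 0) Subset.rfl hX hY hs ht0 (le_of_lt hst)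

/-- A solution started from `x` at a small time stays close to `x` for small times. -/
lemma exists_small_time_bound (x : E d) : ∃ C : ℝ, 0 ≤ C ∧ ∀ a b, 0 < a → a ≤ b → b ≤ 1 →
    ∀ X : ℝ → E d, X a = x → IsIntegralCurveOn X (flowField μ) (Icc a b) →
      ‖X b - x‖ ^ 2 / ouK β b ≤ 1 / min 1 β * (Real.exp (C * b) - 1) := by
  obtain ⟨C, hC⟩ := exists_bound_flowField_zero hβ hφ h x
  have hC0 : 0 ≤ C := (norm_nonneg _).trans (hC 1 ⟨one_pos, le_rfl⟩)
  refine ⟨C, hC0, fun a b ha hab hb X hXa hX => ?_⟩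
  have hI0 : Icc a b ⊆ Ioi 0 := fun t ht => ha.trans_le ht.1
  have h1 := weighted_sq_dist_le_exp hβ hφ h (convex_Icc a b) hI0 hX x (B := fun t => C * t)
    (b := fun _ => C) (fun t _ => by simpa using ((hasDerivAt_id t).const_mul C).hasDerivWithinAt)
    (fun t ht => hC t ⟨hI0 ht, ht.2.trans hb⟩) ⟨le_rfl, hab⟩ ⟨hab, le_rfl⟩ hab
  rw [hXa, sub_self, norm_zero, zero_pow two_ne_zero, zero_div, add_zero] at h1
  have h2 : Real.exp (C * b - C * a) ≤ Real.exp (C * b) :=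
    Real.exp_le_exp.2 (by nlinarith)
  have hm : 0 < 1 / min 1 β := one_div_pos.2 (lt_min one_pos hβ)
  nlinarith

/-- The field may be singular at `t = 0`, so the curve is the limit of the solutions through `x` at
times `a → 0`. These have moved little at small times, and the contraction propagates their
closeness. -/
lemma exists_flow_curve (x : E d) : ∃ X : ℝ → E d, X 0 = x ∧ ContinuousWithinAt X (Ici 0) 0 ∧
    IsIntegralCurveOn X (flowField μ) (Ioi 0) := by
  have hex : ∀ a : ℝ, ∃ γ : ℝ → E d, 0 < a →
      γ a = x ∧ IsIntegralCurveOn γ (flowField μ) (Ici a) := fun a => by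
    by_cases ha : 0 < a
    · obtain ⟨γ, h1⟩ := exists_isIntegralCurveOn_Ici hβ hφ h ha x
      exact ⟨γ, fun _ => h1⟩
    · exact ⟨fun _ => x, fun h => absurd h ha⟩
  choose γ hγ using hex
  obtain ⟨C, hC0, hC⟩ := exists_small_time_bound hβ hφ h x
  set M := max 1 β with hM
  set κ := 1 / min 1 β with hκ
  have hκ0 : 0 < κ := one_div_pos.2 (lt_min one_pos hβ)
  have hM0 : 0 < M := lt_of_lt_of_le one_pos (le_max_left _ _)
  set r : ℝ → ℝ := fun b => Real.sqrt (M * (κ * (Real.exp (C * b) - 1))) with hr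
  have hrc : Continuous r := by fun_prop
  have hr0 : r 0 = 0 := by simp [hr]
  have hstart : ∀ a b, 0 < a → a ≤ b → b ≤ 1 → ∀ t, 0 ≤ t → ∀ D : ℝ, 0 ≤ D →
      D ^ 2 / ouK β t ≤ ‖γ a b - x‖ ^ 2 / ouK β b → D ≤ r b := by
    intro a b ha hab hb t ht D hD hle
    have h1 := hC a b ha hab hb (γ a) (hγ a ha).1 ((hγ a ha).2.mono Icc_subset_Ici_self)
    have hk := ouK_pos hβ ht
    refine Real.le_sqrt_of_sq_le ?_
    have h2 := hle.trans h1
    have h3 : 0 ≤ κ * (Real.exp (C * b) - 1) := (by positivity : (0 : ℝ) ≤ D ^ 2 / ouK β t).trans h2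
    rw [div_le_iff₀ hk] at h2
    calc D ^ 2 ≤ κ * (Real.exp (C * b) - 1) * ouK β t := h2
      _ ≤ κ * (Real.exp (C * b) - 1) * M := by gcongr; exact ouK_le_max β ht
      _ = _ := by ring
  have hrmono : ∀ a b, a ≤ b → r a ≤ r b := fun a b hab => by
    simp only [hr]
    gcongr
  -- The maximum freezes each approximant at `x` before its starting time, so all are compared at
  -- every `t`.
  have hcauchy : ∀ a b, 0 < a → a ≤ b → b ≤ 1 → ∀ t,
      ‖γ a (max a t) - γ b (max b t)‖ ≤ r b := by
    intro a b ha hab hb t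
    have hb0 := ha.trans_le hab
    rcases le_total t b with htb | hbt
    · rw [max_eq_left htb, (hγ b hb0).1]
      have hat : a ≤ max a t := le_max_left _ _
      have htb' : max a t ≤ b := max_le hab htb
      exact (hstart a (max a t) ha hat (htb'.trans hb) (max a t) (ha.le.trans hat) _
        (norm_nonneg _) le_rfl).trans (hrmono _ _ htb')
    · rw [max_eq_right hbt, max_eq_right (hab.trans hbt)]
      have hI0 : Ici b ⊆ Ioi (0 : ℝ) := fun t ht => hb0.trans_le ht
      refine hstart a b ha hab hb t (hb0.le.trans hbt) _ (norm_nonneg _) ?_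
      have := antitoneOn_weighted_sq_dist hβ hφ h (convex_Ici b) hI0
        ((hγ a ha).2.mono (Ici_subset_Ici.2 hab)) (hγ b hb0).2 self_mem_Ici hbt hbt
      simpa only [(hγ b hb0).1] using this
  have hseq0 : Tendsto (fun n : ℕ => (1 : ℝ) / (n + 1)) atTop (𝓝 0) :=
    tendsto_one_div_add_atTop_nhds_zero_nat
  have hlim : ∀ t, ∃ y, Tendsto (fun n : ℕ => γ (1 / (n + 1)) (max (1 / (n + 1)) t)) atTop (𝓝 y) := by
    intro t
    refine cauchySeq_tendsto_of_complete (cauchySeq_of_le_tendsto_0' (fun n : ℕ => r (1 / (n + 1)))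
      (fun n m hnm => ?_) ?_)
    · rw [dist_comm, dist_eq_norm]
      refine hcauchy _ _ Nat.one_div_pos_of_nat (Nat.one_div_le_one_div hnm) ?_ t
      rw [div_le_one (by positivity)]
      have : (0 : ℝ) ≤ n := n.cast_nonneg
      linarith
    · have := (hrc.tendsto 0).comp hseq0
      rwa [hr0] at this
  choose X hX using hlim
  have hXr : ∀ t a, 0 < a → a ≤ 1 → ‖γ a (max a t) - X t‖ ≤ r a := by
    intro t a ha ha1
    refine le_of_tendsto ((hX t).const_sub (γ a (max a t))).norm ?_
    filter_upwards [hseq0.eventually (Iic_mem_nhds ha)] with n hn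
    rw [norm_sub_rev]
    exact hcauchy _ a Nat.one_div_pos_of_nat hn ha1 t
  have hX0 : X 0 = x := by
    refine tendsto_nhds_unique (hX 0) ?_
    refine tendsto_const_nhds.congr fun n => ?_
    have hn : (0 : ℝ) < 1 / (n + 1) := Nat.one_div_pos_of_nat
    rw [max_eq_left hn.le, (hγ _ hn).1]
  have hXx : ∀ t ∈ Ioc (0 : ℝ) 1, ‖X t - X 0‖ ≤ r t := fun t ht => by
    have := hXr t t ht.1 ht.2
    rwa [max_self, (hγ t ht.1).1, norm_sub_rev, ← hX0] at this
  refine ⟨X, hX0, ?_, ?_⟩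
  · rw [← continuousWithinAt_Ioi_iff_Ici, ContinuousWithinAt, tendsto_iff_norm_sub_tendsto_zero]
    have h1 : Tendsto r (𝓝[>] 0) (𝓝 0) := by
      have := (hrc.tendsto 0).mono_left (nhdsWithin_le_nhds (s := Ioi 0))
      rwa [hr0] at this
    refine squeeze_zero' (Eventually.of_forall fun t => norm_nonneg _) ?_ h1
    filter_upwards [self_mem_nhdsWithin, mem_nhdsWithin_of_mem_nhds (Iic_mem_nhds one_pos)]
      with t ht ht1 using hXx t ⟨ht, ht1⟩
  · intro t ht
    have ht0 : (0 : ℝ) < t := ht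
    have ha : 0 < t / 2 := by positivity
    obtain ⟨η, hηa, hη⟩ := exists_isIntegralCurveOn_Ici hβ hφ h ha (X (t / 2))
    have hI0 : Ici (t / 2) ⊆ Ioi (0 : ℝ) := fun s hs => ha.trans_le hs
    -- The equation passes to the limit by stability: the approximants converge at time `t / 2`,
    -- hence by contraction they converge later to the true solution `η` through that limit.
    have heq : EqOn X η (Ici (t / 2)) := by
      intro s hs
      refine tendsto_nhds_unique (hX s) ?_
      rw [tendsto_iff_norm_sub_tendsto_zero]
      have h1 : Tendsto (fun n : ℕ => Real.sqrt (ouK β s / ouK β (t / 2)) *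
          ‖γ (1 / (n + 1)) (max (1 / (n + 1)) (t / 2)) - X (t / 2)‖) atTop (𝓝 0) := by
        simpa using (tendsto_iff_norm_sub_tendsto_zero.1 (hX (t / 2))).const_mul
          (Real.sqrt (ouK β s / ouK β (t / 2)))
      refine squeeze_zero' (Eventually.of_forall fun t => norm_nonneg _) ?_ h1
      filter_upwards [hseq0.eventually (Iic_mem_nhds ha)] with n hn
      have hn0 : (0 : ℝ) < 1 / (n + 1) := Nat.one_div_pos_of_nat
      rw [max_eq_right (le_trans hn hs), max_eq_right hn, ← hηa]
      exact norm_sub_le_of_integralCurve hβ hφ h (convex_Ici _) hI0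
        ((hγ _ hn0).2.mono (Ici_subset_Ici.2 hn)) hη self_mem_Ici hs hs
    have hlt : t / 2 < t := by linarith
    have h1 : HasDerivAt η (flowField μ t (η t)) t := (hη t hlt.le).hasDerivAt (Ici_mem_nhds hlt)
    rw [heq hlt.le]
    exact (h1.congr_of_eventuallyEq (heq.eventuallyEq_of_mem (Ici_mem_nhds hlt))).hasDerivWithinAt

/-- The decay estimate is used twice: at the origin, where with the one-sided bound it confines the
trajectory to a ball, and then on that ball, where it bounds increments by those of a bounded
monotone function. -/
lemma exists_tendsto_of_flow {X : ℝ → E d} (hX : IsIntegralCurveOn X (flowField μ) (Ioi 0)) :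
    ∃ y, Tendsto X atTop (𝓝 y) := by
  have hI0 : Ici (1 : ℝ) ⊆ Ioi 0 := fun t ht => (zero_lt_one' ℝ).trans_le ht
  have hX1 : IsIntegralCurveOn X (flowField μ) (Ici 1) := hX.mono hI0
  set B := decayPrimitive μ with hB
  have hbdd : ∃ R, ∀ t, 1 ≤ t → ‖X t‖ ≤ R := by
    obtain ⟨C, hC0, hC⟩ := exists_bound_flowField_atTop (μ := μ) (0 : ℝ)
    set Q := Real.exp (-(C * B 1)) * (1 / min 1 β + ‖X 1 - 0‖ ^ 2 / ouK β 1) with hQ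
    have hm : 0 < min 1 β := lt_min one_pos hβ
    refine ⟨Real.sqrt (Q * max 1 β), fun t ht => ?_⟩
    have hQ0 : 0 ≤ Q := by
      have := ouK_pos hβ zero_le_one
      positivity
    have h1 := weighted_sq_dist_le_exp hβ hφ h (convex_Ici 1) hI0 hX1 0
      (B := fun t => C * B t) (b := fun t => C * decayRate μ t)
      (fun t _ => ((hasDerivAt_decayPrimitive t).const_mul C).hasDerivWithinAt)
      (fun t ht => hC t ht 0 (by simp)) self_mem_Ici ht ht
    have h2 : Real.exp (C * B t - C * B 1) ≤ Real.exp (-(C * B 1)) := by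
      have := decayPrimitive_nonpos (μ := μ) t
      exact Real.exp_le_exp.2 (by nlinarith)
    have hk := ouK_pos hβ (zero_le_one.trans ht)
    have hk1 := ouK_pos hβ zero_le_one
    have h3 : ‖X t‖ ^ 2 / ouK β t ≤ Q := by
      have h4 : Real.exp (C * B t - C * B 1) * (1 / min 1 β + ‖X 1 - 0‖ ^ 2 / ouK β 1) ≤ Q := by
        rw [hQ]; gcongr
      have h5 : 0 < 1 / min 1 β := by positivity
      rw [sub_zero] at h1
      linarith
    refine Real.le_sqrt_of_sq_le ?_
    rw [div_le_iff₀ hk] at h3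
    exact h3.trans (by gcongr; exact ouK_le_max β (zero_le_one.trans ht))
  obtain ⟨R, hR⟩ := hbdd
  obtain ⟨C, hC0, hC⟩ := exists_bound_flowField_atTop (μ := μ) R
  obtain ⟨l, hl⟩ := exists_tendsto_decayPrimitive (μ := μ)
  have hBl : ∀ t, B t ≤ l := fun t => monotone_decayPrimitive.ge_of_tendsto hl t
  have hinc : ∀ s t, 1 ≤ s → s ≤ t → ‖X t - X s‖ ≤ C * (B t - B s) := by
    intro s t hs hst
    have hsub : Icc s t ⊆ Ioi 0 := fun τ hτ => one_pos.trans_le (hs.trans hτ.1)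
    have hd : ∀ τ ∈ Icc s t, HasDerivAt (fun τ => X τ - X s) (flowField μ τ (X τ)) τ := fun τ hτ =>
      ((hX τ (hsub hτ)).hasDerivAt (Ioi_mem_nhds (hsub hτ))).sub_const _
    exact image_norm_le_of_norm_deriv_right_le_deriv_boundary
      (f' := fun τ => flowField μ τ (X τ)) (B := fun τ => C * (B τ - B s))
      (B' := fun τ => C * decayRate μ τ)
      (fun τ hτ => (hd τ hτ).continuousAt.continuousWithinAt)
      (fun τ hτ => (hd τ (Ico_subset_Icc_self hτ)).hasDerivWithinAt) (by simp)
      (fun τ => ((hasDerivAt_decayPrimitive τ).sub_const _).const_mul C)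
      (fun τ hτ => hC τ (hs.trans hτ.1) _ (hR τ (hs.trans hτ.1))) ⟨hst, le_rfl⟩
  have hcau : CauchySeq (fun t : ℝ => X (max 1 t)) := by
    refine cauchySeq_of_le_tendsto_0' (fun t : ℝ => C * (l - B (max 1 t))) (fun s t hst => ?_) ?_
    · rw [dist_comm, dist_eq_norm]
      refine (hinc _ _ (le_max_left _ _) (max_le_max_left 1 hst)).trans ?_
      gcongr
      exact hBl _
    · have h1 : Tendsto (fun t : ℝ => max 1 t) atTop atTop :=
        tendsto_atTop_mono (fun t => le_max_right 1 t) tendsto_id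
      simpa using ((hl.comp h1).const_sub l).const_mul C
  obtain ⟨y, hy⟩ := cauchySeq_tendsto_of_complete hcau
  refine ⟨y, hy.congr' ?_⟩
  filter_upwards [eventually_ge_atTop 1] with t ht
  rw [max_eq_right ht]

end FlowConstruction

/-! ### Transport of the Ornstein–Uhlenbeck laws between positive times. -/

section FlowTransport

/-- Trajectories of a locally Lipschitz field that meet at the right endpoint coincide. -/
lemma eqOn_of_isIntegralCurveOn_of_eq_right {V : Type*} [NormedAddCommGroup V]
    [InnerProductSpace ℝ V] {v : ℝ → V → V} {a b : ℝ}
    (hlip : ∀ R, ∃ K : ℝ≥0, ∀ t ∈ Icc a b, LipschitzOnWith K (v t) (closedBall 0 R))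
    {X Y : ℝ → V} (hX : IsIntegralCurveOn X v (Icc a b)) (hY : IsIntegralCurveOn Y v (Icc a b))
    (hb : X b = Y b) : EqOn X Y (Icc a b) := by
  have hXc : ContinuousOn X (Icc a b) := fun t ht => (hX t ht).continuousWithinAt
  have hYc : ContinuousOn Y (Icc a b) := fun t ht => (hY t ht).continuousWithinAt
  obtain ⟨R₁, hR₁⟩ := isCompact_Icc.exists_bound_of_continuousOn hXc
  obtain ⟨R₂, hR₂⟩ := isCompact_Icc.exists_bound_of_continuousOn hYc
  obtain ⟨K, hK⟩ := hlip (max R₁ R₂)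
  exact ODE_solution_unique_of_mem_Icc_left (s := fun _ => closedBall 0 (max R₁ R₂))
    (fun t ht => hK t (Ioc_subset_Icc_self ht)) hXc
    (fun t ht => isIntegralCurveOn_hasDerivWithinAt_Iic hX ht)
    (fun t ht => mem_closedBall_zero_iff.2 ((hR₁ t (Ioc_subset_Icc_self ht)).trans
      (le_max_left _ _))) hYc
    (fun t ht => isIntegralCurveOn_hasDerivWithinAt_Iic hY ht)
    (fun t ht => mem_closedBall_zero_iff.2 ((hR₂ t (Ioc_subset_Icc_self ht)).trans
      (le_max_right _ _))) hb

variable {d : ℕ} {μ : Measure (E d)} [IsProbabilityMeasure μ] {β : ℝ} {φ : E d → ℝ}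

/-- Liouville's formula along a trajectory, combined with the continuity equation. -/
lemma exp_logDensity_mul_det_eq {a b : ℝ} (ha : 0 < a) (hab : a ≤ b) {γ : ℝ → E d}
    (hγ : IsIntegralCurveOn γ (flowField μ) (Icc a b)) {J : ℝ → E d →L[ℝ] E d}
    (hJ0 : J a = ContinuousLinearMap.id ℝ (E d))
    (hJ : ∀ t ∈ Icc a b, ∀ w, HasDerivWithinAt (fun τ => J τ w)
      (flowFieldDeriv μ t (γ t) (J t w)) (Icc a b) t) :
    Real.exp (logDensity μ b (γ b)) * (J b).det = Real.exp (logDensity μ a (γ a)) := by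
  -- The log-density falls at the rate of the divergence and the determinant grows at it, so the
  -- product is constant.
  have hd : IsIntegralCurveOn (fun τ => Real.exp (logDensity μ τ (γ τ)) * (J τ).det)
      (fun _ _ => 0) (Icc a b) := fun t ht => by
    have h1 := (hasDerivWithinAt_logDensity (stdOrthonormalBasis ℝ (E d)) (ha.trans_le ht.1)
      (hγ t ht)).exp
    have h2 := hasDerivWithinAt_det (stdOrthonormalBasis ℝ (E d)) (hJ t ht)
    refine (h1.mul h2).congr_deriv ?_
    ring
  have := constant_of_has_deriv_right_zero (fun t ht => (hd t ht).continuousWithinAt)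
    (fun t ht => isIntegralCurveOn_hasDerivWithinAt_Ici hd ht) b ⟨hab, le_rfl⟩
  have hdet : (ContinuousLinearMap.id ℝ (E d)).det = 1 := by
    rw [ContinuousLinearMap.det]; exact LinearMap.det_id
  rw [this, hJ0, hdet, mul_one]

section Transport

variable (hβ : 0 < β) (hφ : ConvexOn ℝ univ φ) (h : HasPotential β φ μ)

include hβ hφ h

lemma continuous_flowMap {a b : ℝ} (ha : 0 < a) (hab : a ≤ b) {X : E d → ℝ → E d}
    (hX0 : ∀ y, X y a = y) (hX : ∀ y, IsIntegralCurveOn (X y) (flowField μ) (Icc a b)) :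
    Continuous fun y => X y b := by
  have hI0 : Icc a b ⊆ Ioi 0 := fun t ht => ha.trans_le ht.1
  refine (LipschitzWith.of_dist_le_mul (K := Real.toNNReal (Real.sqrt (ouK β b / ouK β a)))
    fun y z => ?_).continuous
  rw [dist_eq_norm, dist_eq_norm, Real.coe_toNNReal _ (Real.sqrt_nonneg _)]
  simpa only [hX0] using norm_sub_le_of_integralCurve hβ hφ h (convex_Icc a b) hI0 (hX y) (hX z)
    ⟨le_rfl, hab⟩ ⟨hab, le_rfl⟩ hab

/-- The flow transports the Ornstein–Uhlenbeck law at time `a` to the one at time `b`. -/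
lemma map_flow_ouLaw {a b : ℝ} (ha : 0 < a) (hab : a ≤ b) {X : E d → ℝ → E d}
    (hX0 : ∀ y, X y a = y) (hX : ∀ y, IsIntegralCurveOn (X y) (flowField μ) (Icc a b)) :
    (ouLaw μ a).map (fun y => X y b) = ouLaw μ b := by
  have hI0 : Icc a b ⊆ Ioi 0 := fun t ht => ha.trans_le ht.1
  have hcont := continuous_flowMap hβ hφ h ha hab hX0 hX
  set M := max 1 β with hM
  set m := min 1 β with hm
  have hm0 : 0 < m := lt_min one_pos hβ
  have hK : ∀ y z, ∀ t ∈ Icc a b, ‖X y t - X z t‖ ≤ Real.sqrt (M / m) * ‖y - z‖ := by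
    intro y z t ht
    have h1 := norm_sub_le_of_integralCurve hβ hφ h (convex_Icc a b) hI0 (hX y) (hX z)
      ⟨le_rfl, hab⟩ ht ht.1
    rw [hX0, hX0] at h1
    refine h1.trans ?_
    have h2 := ouK_le_max β (hI0 ht : (0 : ℝ) < t).le
    have h3 := min_one_le_ouK β ha.le
    have h4 : 0 ≤ M := zero_le_one.trans (le_max_left _ _)
    gcongr
  have hinj : Function.Injective fun y => X y b := fun y z hyz => by
    have := eqOn_of_isIntegralCurveOn_of_eq_right (fun R => lipschitzOnWith_flowField ha R)
      (hX y) (hX z) hyz ⟨le_rfl, hab⟩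
    rwa [hX0, hX0] at this
  have hex : ∀ y, ∃ D : E d →L[ℝ] E d, HasFDerivAt (fun y => X y b) D y ∧
      Real.exp (logDensity μ b (X y b)) * D.det = Real.exp (logDensity μ a y) := by
    intro y
    have hA : ContinuousOn (fun t => flowFieldDeriv μ t (X y t)) (Icc a b) :=
      (continuousOn_flowFieldDeriv (μ := μ)).comp (f := fun t => (t, X y t))
        (continuousOn_id.prodMk fun t ht => (hX y t ht).continuousWithinAt)
        fun t ht => ⟨hI0 ht, mem_univ _⟩
    obtain ⟨J, hJ0, hJ⟩ := exists_fundamental_solution hab hA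
    refine ⟨J b, hasFDerivAt_flow hab (Real.sqrt_nonneg _)
      (fun t ht y => hasFDerivAt_flowField (hI0 ht) y)
      (continuousOn_flowFieldDeriv.mono (prod_mono hI0 Subset.rfl)) hX0 hX hK y hJ0 hJ, ?_⟩
    rw [exp_logDensity_mul_det_eq ha hab (hX y) hJ0 hJ, hX0]
  choose D hD hdet using hex
  have hc := gaussConst_pos d
  -- The change of variables only sees the image of the flow, so surjectivity is not needed: an
  -- inequality between probability measures is an equality.
  have hle : (ouLaw μ a).map (fun y => X y b) ≤ ouLaw μ b := by
    refine Measure.le_iff.2 fun s hs => ?_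
    have hs' : MeasurableSet ((fun y => X y b) ⁻¹' s) := hcont.measurable hs
    rw [Measure.map_apply hcont.measurable hs, ouLaw_eq_withDensity ha,
      ouLaw_eq_withDensity (ha.trans_le hab), withDensity_apply _ hs', withDensity_apply _ hs]
    calc ∫⁻ y in (fun y => X y b) ⁻¹' s,
          ENNReal.ofReal (gaussConst d * Real.exp (logDensity μ a y))
        = ∫⁻ y in (fun y => X y b) ⁻¹' s, ENNReal.ofReal |(D y).det| *
          ENNReal.ofReal (gaussConst d * Real.exp (logDensity μ b (X y b))) := by
          congr 1
          ext y
          have h1 : 0 < (D y).det := by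
            have h2 := hdet y ▸ Real.exp_pos (logDensity μ a y)
            exact pos_of_mul_pos_right h2 (Real.exp_pos _).le
          rw [← ENNReal.ofReal_mul (abs_nonneg _), abs_of_pos h1, ← hdet y]
          congr 1
          ring
      _ = ∫⁻ z in (fun y => X y b) '' ((fun y => X y b) ⁻¹' s),
          ENNReal.ofReal (gaussConst d * Real.exp (logDensity μ b z)) :=
          (lintegral_image_eq_lintegral_abs_det_fderiv_mul volume hs'
            (fun y _ => (hD y).hasFDerivWithinAt) hinj.injOn
            (fun z => ENNReal.ofReal (gaussConst d * Real.exp (logDensity μ b z)))).symm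
      _ ≤ _ := lintegral_mono_set (image_preimage_subset _ _)
  have : IsProbabilityMeasure ((ouLaw μ a).map (fun y => X y b)) :=
    Measure.isProbabilityMeasure_map hcont.aemeasurable
  exact Measure.eq_of_le_of_isProbabilityMeasure hle

end Transport

end FlowTransport

/-! ### Endpoints of the transport and conclusion. -/

section Limit

variable {d : ℕ} {μ : Measure (E d)} [IsProbabilityMeasure μ] {β : ℝ} {φ : E d → ℝ}

lemma continuous_ouVar : Continuous ouVar := by unfold ouVar; fun_prop

lemma integral_ouLaw (g : BoundedContinuousFunction (E d) ℝ) (t : ℝ) :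
    ∫ x, g x ∂ouLaw μ t = ∫ p : E d × E d, g (Real.exp (-t) • p.1 + Real.sqrt (ouVar t) • p.2)
      ∂(μ.prod (gaussian d)) := by
  rw [ouLaw, integral_map (Continuous.aemeasurable (by fun_prop))
    g.continuous.aestronglyMeasurable]

lemma tendsto_integral_ouLaw_atTop (g : BoundedContinuousFunction (E d) ℝ) :
    Tendsto (fun t => ∫ x, g x ∂ouLaw μ t) atTop (𝓝 (∫ x, g x ∂gaussian d)) := by
  have hR : ∫ x, g x ∂gaussian d = ∫ p : E d × E d, g p.2 ∂(μ.prod (gaussian d)) := by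
    have := integral_fun_snd (μ := μ) (ν := gaussian d) (fun x => g x)
    simpa using this.symm
  simp_rw [integral_ouLaw, hR]
  refine tendsto_integral_filter_of_dominated_convergence (fun _ => ‖g‖)
    (Eventually.of_forall fun t => Continuous.aestronglyMeasurable (by fun_prop))
    (Eventually.of_forall fun t => Eventually.of_forall fun p => g.norm_coe_le_norm _)
    (integrable_const _) (Eventually.of_forall fun p => (g.continuous.tendsto _).comp ?_)
  have h1 : Tendsto (fun t : ℝ => Real.exp (-t)) atTop (𝓝 0) :=
    Real.tendsto_exp_atBot.comp tendsto_neg_atTop_atBot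
  have h2 : Tendsto (fun t : ℝ => Real.exp (-2 * t)) atTop (𝓝 0) :=
    Real.tendsto_exp_atBot.comp (tendsto_id.const_mul_atTop_of_neg (by norm_num))
  have h3 : Tendsto (fun t : ℝ => Real.sqrt (ouVar t)) atTop (𝓝 1) := by
    have h4 : Tendsto ouVar atTop (𝓝 1) := by
      have := h2.const_sub 1
      rwa [sub_zero] at this
    have := (Real.continuous_sqrt.tendsto 1).comp h4
    rwa [Real.sqrt_one] at this
  simpa using (h1.smul_const p.1).add (h3.smul_const p.2)

section Flow

variable (hβ : 0 < β) (hφ : ConvexOn ℝ univ φ) (h : HasPotential β φ μ)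

include hβ hφ h

/-- The flow started from `μ` has the Ornstein–Uhlenbeck law at every positive time. -/
lemma integral_comp_flow {S : ℝ → E d → E d} (hS0 : ∀ x, S 0 x = x)
    (hSc : ∀ x, ContinuousWithinAt (fun t => S t x) (Ici 0) 0)
    (hS : ∀ x, IsIntegralCurveOn (fun t => S t x) (flowField μ) (Ioi 0))
    {T : ℝ} (hT : 0 < T) (g : BoundedContinuousFunction (E d) ℝ) :
    ∫ x, g (S T x) ∂μ = ∫ x, g x ∂ouLaw μ T := by
  have hex : ∀ a : ℝ, ∀ y : E d, ∃ γ : ℝ → E d, 0 < a →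
      γ a = y ∧ IsIntegralCurveOn γ (flowField μ) (Ici a) := fun a y => by
    by_cases ha : 0 < a
    · obtain ⟨γ, h1⟩ := exists_isIntegralCurveOn_Ici hβ hφ h ha y
      exact ⟨γ, fun _ => h1⟩
    · exact ⟨fun _ => y, fun h => absurd h ha⟩
  choose X hX using hex
  -- A coupling: `Z a` has law `ouLaw μ a` and tends pointwise to the first coordinate, of law `μ`.
  -- By contraction, flowing from `Z a` at time `a` up to `T` tends to `S T` of that coordinate,
  -- while the law at `T` does not depend on `a`.
  set Z : ℝ → E d × E d → E d := fun a p => Real.exp (-a) • p.1 + Real.sqrt (ouVar a) • p.2 with hZ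
  have hsmall : ∀ᶠ a in 𝓝[>] (0 : ℝ), 0 < a ∧ a ≤ T := by
    filter_upwards [self_mem_nhdsWithin, mem_nhdsWithin_of_mem_nhds (Iic_mem_nhds hT)]
      with a h1 h2 using ⟨h1, h2⟩
  have hXc : ∀ a, 0 < a → a ≤ T → Continuous fun y => X a y T := fun a ha haT =>
    continuous_flowMap hβ hφ h ha haT (fun y => (hX a y ha).1)
      (fun y => (hX a y ha).2.mono Icc_subset_Ici_self)
  have hZc : ∀ a, Continuous (Z a) := fun a => by fun_prop
  have hZ0 : ∀ p, Tendsto (fun a => Z a p) (𝓝[>] 0) (𝓝 p.1) := fun p => by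
    have h1 : Continuous fun a => Z a p := by
      have := continuous_ouVar
      fun_prop
    have h2 := (h1.tendsto 0).mono_left (nhdsWithin_le_nhds (s := Ioi 0))
    have h3 : Z 0 p = p.1 := by simp [hZ, ouVar]
    rwa [h3] at h2
  have hpt : ∀ p : E d × E d, Tendsto (fun a => X a (Z a p) T) (𝓝[>] 0) (𝓝 (S T p.1)) := by
    intro p
    rw [tendsto_iff_norm_sub_tendsto_zero]
    have hlim : Tendsto (fun a => Real.sqrt (ouK β T / ouK β a) * ‖Z a p - S a p.1‖) (𝓝[>] 0)
        (𝓝 0) := by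
      have h1 : Tendsto (fun a => S a p.1) (𝓝[>] 0) (𝓝 p.1) := by
        have := (hSc p.1).mono (Ioi_subset_Ici_self)
        rwa [ContinuousWithinAt, hS0] at this
      have h2 : Tendsto (fun a => Real.sqrt (ouK β T / ouK β a)) (𝓝[>] 0)
          (𝓝 (Real.sqrt (ouK β T / ouK β 0))) :=
        (Real.continuous_sqrt.tendsto _).comp (tendsto_const_nhds.div
          (((continuous_ouK β).tendsto 0).mono_left nhdsWithin_le_nhds)
          (by rw [ouK_zero]; exact one_ne_zero))
      simpa using h2.mul ((hZ0 p).sub h1).norm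
    refine squeeze_zero' (Eventually.of_forall fun a => norm_nonneg _) ?_ hlim
    filter_upwards [hsmall] with a ha
    have hI0 : Ici a ⊆ Ioi (0 : ℝ) := fun t ht => ha.1.trans_le ht
    have := norm_sub_le_of_integralCurve hβ hφ h (convex_Ici a) hI0 (hX a (Z a p) ha.1).2
      ((hS p.1).mono hI0) self_mem_Ici ha.2 ha.2
    rwa [(hX a (Z a p) ha.1).1] at this
  have hconst : ∀ a, 0 < a → a ≤ T →
      ∫ p, g (X a (Z a p) T) ∂(μ.prod (gaussian d)) = ∫ x, g x ∂ouLaw μ T := by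
    intro a ha haT
    rw [← map_flow_ouLaw hβ hφ h ha haT (fun y => (hX a y ha).1)
      (fun y => (hX a y ha).2.mono Icc_subset_Ici_self),
      integral_map (hXc a ha haT).aemeasurable g.continuous.aestronglyMeasurable]
    exact (integral_ouLaw (g.compContinuous ⟨_, hXc a ha haT⟩) a).symm
  have hlim : Tendsto (fun a => ∫ p, g (X a (Z a p) T) ∂(μ.prod (gaussian d))) (𝓝[>] 0)
      (𝓝 (∫ p : E d × E d, g (S T p.1) ∂(μ.prod (gaussian d)))) := by
    refine tendsto_integral_filter_of_dominated_convergence (fun _ => ‖g‖) ?_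
      (Eventually.of_forall fun t => Eventually.of_forall fun p => g.norm_coe_le_norm _)
      (integrable_const _) (Eventually.of_forall fun p => (g.continuous.tendsto _).comp (hpt p))
    filter_upwards [hsmall] with a ha
    exact (g.continuous.comp ((hXc a ha.1 ha.2).comp (hZc a))).aestronglyMeasurable
  have heq := tendsto_nhds_unique (hlim.congr' (hsmall.mono fun a ha => hconst a ha.1 ha.2))
    tendsto_const_nhds
  rw [← heq]
  have := integral_fun_fst (μ := μ) (ν := gaussian d) (fun x => g (S T x))
  simpa using this.symm

lemma lipschitzWith_limit {S : ℝ → E d → E d} (hS0 : ∀ x, S 0 x = x)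
    (hSc : ∀ x, ContinuousWithinAt (fun t => S t x) (Ici 0) 0)
    (hS : ∀ x, IsIntegralCurveOn (fun t => S t x) (flowField μ) (Ioi 0)) {Ψ : E d → E d}
    (hΨ : ∀ x, Tendsto (fun t => S t x) atTop (𝓝 (Ψ x))) :
    LipschitzWith (Real.toNNReal (Real.sqrt β)) Ψ := by
  refine LipschitzWith.of_dist_le_mul fun x y => ?_
  rw [dist_eq_norm, dist_eq_norm, Real.coe_toNNReal _ (Real.sqrt_nonneg _)]
  refine le_of_tendsto_of_tendsto ((hΨ x).sub (hΨ y)).norm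
    (((Real.continuous_sqrt.tendsto β).comp (tendsto_ouK_atTop β)).mul_const ‖x - y‖) ?_
  filter_upwards [eventually_ge_atTop 0] with t ht
  have := norm_sub_le_of_flow hβ hφ h (hS x) (hSc x) (hS y) (hSc y) ht
  rwa [hS0, hS0] at this

/-- For bounded continuous tests, the law of `S t` converges to that of `Ψ` by dominated
convergence, and it equals `ouLaw μ t`, which converges to `γ_d`. -/
lemma map_limit_eq_gaussian {S : ℝ → E d → E d} (hS0 : ∀ x, S 0 x = x)
    (hSc : ∀ x, ContinuousWithinAt (fun t => S t x) (Ici 0) 0)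
    (hS : ∀ x, IsIntegralCurveOn (fun t => S t x) (flowField μ) (Ioi 0)) {Ψ : E d → E d}
    (hΨ : ∀ x, Tendsto (fun t => S t x) atTop (𝓝 (Ψ x))) : μ.map Ψ = gaussian d := by
  have hΨc : Continuous Ψ := (lipschitzWith_limit hβ hφ h hS0 hSc hS hΨ).continuous
  have hStc : ∀ t, 0 ≤ t → Continuous (S t) := fun t ht => by
    refine (LipschitzWith.of_dist_le_mul (K := Real.toNNReal (Real.sqrt (ouK β t)))
      fun x y => ?_).continuous
    rw [dist_eq_norm, dist_eq_norm, Real.coe_toNNReal _ (Real.sqrt_nonneg _)]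
    simpa only [hS0] using norm_sub_le_of_flow hβ hφ h (hS x) (hSc x) (hS y) (hSc y) ht
  have : IsProbabilityMeasure (μ.map Ψ) := Measure.isProbabilityMeasure_map hΨc.aemeasurable
  refine ext_of_forall_integral_eq_of_IsFiniteMeasure fun g => ?_
  rw [integral_map hΨc.aemeasurable g.continuous.aestronglyMeasurable]
  have h1 : Tendsto (fun t => ∫ x, g (S t x) ∂μ) atTop (𝓝 (∫ x, g (Ψ x) ∂μ)) := by
    refine tendsto_integral_filter_of_dominated_convergence (fun _ => ‖g‖) ?_
      (Eventually.of_forall fun t => Eventually.of_forall fun p => g.norm_coe_le_norm _)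
      (integrable_const _) (Eventually.of_forall fun x => (g.continuous.tendsto _).comp (hΨ x))
    filter_upwards [eventually_ge_atTop 0] with t ht
    exact (g.continuous.comp (hStc t ht)).aestronglyMeasurable
  refine tendsto_nhds_unique h1 ((tendsto_integral_ouLaw_atTop (μ := μ) g).congr' ?_)
  filter_upwards [eventually_gt_atTop 0] with t ht
  exact (integral_comp_flow hβ hφ h hS0 hSc hS ht g).symm

end Flow

lemma IsSemiLogConvex.exists_hasPotential (hμ : IsSemiLogConvex β μ) :
    ∃ φ : E d → ℝ, ConvexOn ℝ univ φ ∧ HasPotential β φ μ := by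
  obtain ⟨ρ, hρ, hμρ, hconv⟩ := hμ
  refine ⟨fun x => Real.log (ρ x) + β / 2 * ‖x‖ ^ 2, hconv,
    continuousOn_univ.1 (hconv.continuousOn isOpen_univ), ?_⟩
  rw [hμρ]
  congr 1
  ext x
  rw [add_sub_cancel_right, Real.exp_log (hρ x)]

lemma HasPotential.absolutelyContinuous_gaussian (h : HasPotential β φ μ) : μ ≪ gaussian d := by
  have h1 : μ ≪ (volume : Measure (E d)) := h.2 ▸ withDensity_absolutelyContinuous _ _
  refine h1.trans ?_
  rw [gaussian_eq_withDensity]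
  refine withDensity_absolutelyContinuous'
    (continuous_gaussDensity 1 0).measurable.ennreal_ofReal.aemeasurable
    (Eventually.of_forall fun x => ?_)
  exact (ENNReal.ofReal_pos.2 (gaussDensity_pos one_pos 0 x)).ne'

lemma IsHeatFlow.isIntegralCurveOn (hμ : μ ≪ gaussian d) {S : ℝ → E d → E d}
    (hS : IsHeatFlow μ S) (x : E d) :
    IsIntegralCurveOn (fun t => S t x) (flowField μ) (Ioi 0) := fun t ht => by
  have := hS.ode x t ht
  rw [velocity_eq_flowField hμ ht] at this
  exact this.hasDerivWithinAt

theorem exists_isInverseKimMilmanMap (hβ : 0 < β) (hμ : IsSemiLogConvex β μ) :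
    ∃ Ψ : E d → E d, IsInverseKimMilmanMap μ Ψ ∧ MeasurePreserving Ψ μ (gaussian d) ∧
      ∀ᵐ x ∂(volume : Measure (E d)), DifferentiableAt ℝ Ψ x ∧ ‖fderiv ℝ Ψ x‖ ≤ Real.sqrt β := by
  obtain ⟨φ, hφ, h⟩ := hμ.exists_hasPotential
  have hac := h.absolutelyContinuous_gaussian
  choose X hX0 hXc hX using exists_flow_curve hβ hφ h
  choose Ψ hΨ using fun x => exists_tendsto_of_flow hβ hφ h (hX x)
  have hflow : IsHeatFlow μ (fun t x => X x t) := by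
    refine ⟨hX0, hXc, fun x t ht => ?_⟩
    rw [velocity_eq_flowField hac ht]
    exact (hX x t ht).hasDerivAt (Ioi_mem_nhds ht)
  have hunique : ∀ S S', IsHeatFlow μ S → IsHeatFlow μ S' → ∀ t, 0 ≤ t → S t = S' t := by
    intro S S' hS hS' t ht
    ext1 x
    have := norm_sub_le_of_flow hβ hφ h (hS.isIntegralCurveOn hac x) (hS.continuous_zero x)
      (hS'.isIntegralCurveOn hac x) (hS'.continuous_zero x) ht
    rw [hS.initial, hS'.initial, sub_self, norm_zero, mul_zero] at this
    exact sub_eq_zero.1 (norm_le_zero_iff.1 this)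
  have hlip := lipschitzWith_limit hβ hφ h (S := fun t x => X x t) hX0 hXc hX hΨ
  refine ⟨Ψ, ⟨⟨_, hflow⟩, hunique, fun S hS x => ?_⟩, ⟨hlip.continuous.measurable,
    map_limit_eq_gaussian hβ hφ h (S := fun t x => X x t) hX0 hXc hX hΨ⟩, ?_⟩
  · refine (hΨ x).congr' ?_
    filter_upwards [Filter.eventually_ge_atTop 0] with t ht
    exact congrFun (hunique _ _ hflow hS t ht) x
  -- Rademacher's theorem; at a point of differentiability the Lipschitz constant bounds the
  -- derivative.
  · filter_upwards [hlip.ae_differentiableAt] with x hx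
    refine ⟨hx, (norm_fderiv_le_of_lipschitz ℝ hlip).trans_eq ?_⟩
    exact Real.coe_toNNReal _ (Real.sqrt_nonneg _)

end Limit

end KimMilman

end

theorem theorem1p3 (d : ℕ) (β : ℝ) (hβ : 0 < β)
    (μ : MeasureTheory.Measure (KimMilman.E d)) [MeasureTheory.IsProbabilityMeasure μ]
    (hμ : KimMilman.IsSemiLogConvex β μ) :
    ∃ Ψ : KimMilman.E d → KimMilman.E d,
      KimMilman.IsInverseKimMilmanMap μ Ψ ∧
      MeasureTheory.MeasurePreserving Ψ μ (KimMilman.gaussian d) ∧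
      ∀ᵐ x ∂(MeasureTheory.volume : MeasureTheory.Measure (KimMilman.E d)),
        DifferentiableAt ℝ Ψ x ∧ ‖fderiv ℝ Ψ x‖ ≤ Real.sqrt β :=
  KimMilman.exists_isInverseKimMilmanMap hβ hμ
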